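/- Let $k$ be a field and $X$ a scheme of finite type over $k$. Let $\mathrm{Lin}(X)$ be the category of representable linear spaces over $X$: $\mathbb A^1_X$-modules $L\to X$, affine and of finite type over $X$, that are locally on $X$ kernels of homomorphisms of trivial vector bundles $\mathbb A^n_U\to\mathbb A^m_U$; equivalently $L=\mathrm{Spec}_{\mathcal O_X}\mathrm{Sym}\,\mathcal F$ with $\mathcal F$ coherent, and $\mathrm{Lin}(X)$ is anti-equivalent to $\mathrm{Coh}(X)$. A cone $C\subset L$ is a closed subscheme defined by a homogeneous ideal of $\mathrm{Sym}\,\mathcal F$ whose degree-$0$ part is zero. For a homomorphism $D:L'\to L$ in $\mathrm{Lin}(X)$, the cone $C$ is called an $L'$-cone if it is preserved by the additive action of $L'$ on $L$ through $D$. A two-term complex is a morphism $F_\bullet=(F_0\xrightarrow{D_F}F_1)$ of $\mathrm{Lin}(X)$; write $H^0(F_\bullet)$ and $H^1(F_\bullet)$ for the kernel and the cokernel of $D_F$ in $\mathrm{Lin}(X)$. A morphism $\Phi=(\Phi_0,\Phi_1):F_\bullet\to E_\bullet$ of two-term complexes is a commutative square. Going down is applicable to $\Phi$ if $F_0$ is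 a vector bundle and $\Phi$ induces an isomorphism on $H^0$ and a closed embedding of linear spaces on $H^1$. Let $q_\Phi=D_E\circ\mathrm{pr}_1+\Phi_1\circ\mathrm{pr}_2:E_0\oplus F_1\to E_1$. In that case, for an $F_0$-cone $C\subset F_1$, the push-forward $\Phi_!(C)$ is the unique cone $\bar C\subset\operatorname{im}q_\Phi\subset E_1$ (image in $\mathrm{Lin}(X)$) with $q_\Phi^{-1}(\bar C)=E_0\oplus C$ as closed subschemes of $E_0\oplus F_1$. **Proposition (Going down is functorial).** Let $\Psi:G_\bullet\to F_\bullet$ and $\Phi:F_\bullet\to E_\bullet$ be morphisms of two-term complexes of linear spaces over $X$ to which going down is applicable, and let $C\subset G_1$ be a $G_0$-cone. Then going down is applicable to $\Phi\circ\Psi$; the push-forwards $\Psi_!(C)$, $\Phi_!(\Psi_!(C))$ and $(\Phi\circ\Psi)_!(C)$ exist and are unique, $\Psi_!(C)$ is an $F_0$-cone, and $$(\Phi\circ\Psi)_!(C)=\Phi_!(\Psi_!(C)).$$ -/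

import Mathlib

open CategoryTheory AlgebraicGeometry

universe u

namespace LinearSpaces

variable {X : Scheme.{u}}

/-- An `𝔸¹_X`-module of finite type over `X`: an affine morphism `L ⟶ X` of finite type (an affine
morphism is quasi-compact) with a module structure over the ring scheme `𝔸¹_X`. Since `𝔸¹_X`
represents the functor `T ↦ Γ(T, 𝒪_T)` on `X`-schemes, the structure morphisms (addition, zero
section, scalar multiplication) and the module axioms are given, through the Yoneda lemma, by
`Γ(T, 𝒪_T)`-module structures on the sets `L(T)` of `T`-valued points, natural in `T`. -/
structure LinearSpace (X : Scheme.{u}) where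
  /-- the underlying `X`-scheme -/
  toOver : Over X
  isAffineHom : IsAffineHom toOver.hom
  locallyOfFiniteType : LocallyOfFiniteType toOver.hom
  addCommGroup : ∀ T : Over X, AddCommGroup (T ⟶ toOver)
  module : ∀ T : Over X, Module Γ(T.left, ⊤) (T ⟶ toOver)
  comp_add : ∀ {T' T : Over X} (f : T' ⟶ T) (s t : T ⟶ toOver),
    f ≫ (s + t) = f ≫ s + f ≫ t
  comp_smul : ∀ {T' T : Over X} (f : T' ⟶ T) (a : Γ(T.left, ⊤)) (s : T ⟶ toOver),
    f ≫ (a • s) = f.left.appTop a • (f ≫ s)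

attribute [instance] LinearSpace.addCommGroup LinearSpace.module

/-- `T` lies over the open subscheme `U` of `X`. -/
def LiesOver (T : Over X) (U : X.Opens) : Prop :=
  ⊤ ≤ T.hom ⁻¹ᵁ U

/-- A linear form on `L` over the open subscheme `U` of `X`: a homomorphism `L|_U ⟶ 𝔸¹_U` of
`𝔸¹_U`-modules, given on points with values in `U`-schemes `T`. These are the sections over `U` of
the `𝒪_X`-module `ℋom(L, 𝔸¹_X)` corresponding to `L`. -/
structure LinearForm (L : LinearSpace X) (U : X.Opens) where
  /-- the action on `T`-valued points -/
  onPoints : ∀ T : Over X, LiesOver T U → ((T ⟶ L.toOver) →ₗ[Γ(T.left, ⊤)] Γ(T.left, ⊤))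
  naturality : ∀ {T' T : Over X} (hT' : LiesOver T' U) (hT : LiesOver T U) (f : T' ⟶ T)
    (s : T ⟶ L.toOver), onPoints T' hT' (f ≫ s) = f.left.appTop (onPoints T hT s)

/-- `L` is representable: locally on `X` it is a closed linear subspace of a trivial vector bundle
`𝔸ⁿ_U`, cut out by finitely many linear equations, that is, the kernel of a homomorphism
`𝔸ⁿ_U ⟶ 𝔸ᵐ_U` given by a matrix `A`. Over a locally noetherian `X` these are exactly
the linear spaces `Spec Sym ℱ` with `ℱ` coherent. -/
def LinearSpace.IsRepresentable (L : LinearSpace X) : Prop :=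
  ∀ x : X, ∃ U : X.Opens, x ∈ U ∧ ∃ (n m : ℕ) (ℓ : Fin n → LinearForm L U)
    (A : Matrix (Fin m) (Fin n) Γ(X, U)),
    ∀ (T : Over X) (hT : LiesOver T U),
      Function.Injective (fun (s : T ⟶ L.toOver) (i : Fin n) => (ℓ i).onPoints T hT s) ∧
      Set.range (fun (s : T ⟶ L.toOver) (i : Fin n) => (ℓ i).onPoints T hT s) =
        {v : Fin n → Γ(T.left, ⊤) |
          ∀ j, ∑ i, (T.hom.appLE U ⊤ hT (A j i) : Γ(T.left, ⊤)) * v i = 0}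

/-- `L` is a vector bundle: locally on `X` it is isomorphic, as a linear space, to `𝔸ⁿ_U`. -/
def LinearSpace.IsVectorBundle (L : LinearSpace X) : Prop :=
  ∀ x : X, ∃ U : X.Opens, x ∈ U ∧ ∃ (n : ℕ) (ℓ : Fin n → LinearForm L U),
    ∀ (T : Over X) (hT : LiesOver T U),
      Function.Bijective (fun (s : T ⟶ L.toOver) (i : Fin n) => (ℓ i).onPoints T hT s)

/-- A homomorphism of linear spaces over `X`. -/
@[ext]
structure LinearHom (L M : LinearSpace X) where
  /-- the underlying morphism of `X`-schemes -/
  toHom : L.toOver ⟶ M.toOver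
  map_add : ∀ {T : Over X} (s t : T ⟶ L.toOver), (s + t) ≫ toHom = s ≫ toHom + t ≫ toHom
  map_smul : ∀ {T : Over X} (a : Γ(T.left, ⊤)) (s : T ⟶ L.toOver),
    (a • s) ≫ toHom = a • (s ≫ toHom)

/-- The objects of the category `Lin(X)` of representable linear spaces over `X`. -/
structure Lin (X : Scheme.{u}) where
  /-- the underlying linear space -/
  space : LinearSpace X
  isRepresentable : space.IsRepresentable

instance : Category (Lin X) where
  Hom L M := LinearHom L.space M.space
  id L :=
    { toHom := 𝟙 _
      map_add := fun s t => by simp only [Category.comp_id]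
      map_smul := fun a s => by simp only [Category.comp_id] }
  comp f g :=
    { toHom := f.toHom ≫ g.toHom
      map_add := fun s t => by simp only [← Category.assoc, f.map_add, g.map_add]
      map_smul := fun a s => by simp only [← Category.assoc, f.map_smul, g.map_smul] }
  id_comp f := LinearHom.ext (Category.id_comp _)
  comp_id f := LinearHom.ext (Category.comp_id _)
  assoc f g h := LinearHom.ext (Category.assoc _ _ _)

/-- The underlying `X`-scheme of a linear space. -/
abbrev Lin.over (L : Lin X) : Over X := L.space.toOver

/-- The morphism of `X`-schemes underlying a morphism of `Lin(X)`. -/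
abbrev homOver {L M : Lin X} (f : L ⟶ M) : L.over ⟶ M.over := LinearHom.toHom f

/-- A `T`-valued point of an `X`-scheme `Y` factors through the closed subscheme `I` of `Y`. -/
def FactorsThrough {T Y : Over X} (s : T ⟶ Y) (I : Y.left.IdealSheafData) : Prop :=
  ∃ t : T.left ⟶ I.subscheme, t ≫ I.subschemeι = s.left

/-- A cone `C ⊆ L` over `X` in a linear space `L = Spec Sym ℱ`: a closed subscheme `Spec S` whose
ideal is homogeneous (that is, `C` is stable under scalar multiplication `𝔸¹_X ×_X L ⟶ L`) and has
zero component of degree `0`, so that `S⁰ = 𝒪_X` (that is, `C` contains the zero section). -/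
@[ext]
structure LinCone (L : Lin X) where
  /-- the ideal sheaf of the closed subscheme -/
  ideal : L.over.left.IdealSheafData
  zero_mem : ∀ T : Over X, FactorsThrough (0 : T ⟶ L.over) ideal
  smul_mem : ∀ (T : Over X) (a : Γ(T.left, ⊤)) (s : T ⟶ L.over),
    FactorsThrough s ideal → FactorsThrough (a • s) ideal

/-- `L`, as a cone in itself. -/
noncomputable def LinCone.whole (L : Lin X) : LinCone L where
  ideal := ⊥
  zero_mem T := ⟨(0 : T ⟶ L.over).left ≫ inv (Scheme.IdealSheafData.subschemeι ⊥), by simp⟩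
  smul_mem T a s _ := ⟨(a • s).left ≫ inv (Scheme.IdealSheafData.subschemeι ⊥), by simp⟩

/-- For a homomorphism `Φ : E ⟶ F`, the cone `C ⊆ F` is an `E`-cone: it is preserved by the
additive action of `E` on `F` through `Φ`. -/
def LinCone.IsConeUnder {E F : Lin X} (C : LinCone F) (Φ : E ⟶ F) : Prop :=
  ∀ (T : Over X) (e : T ⟶ E.over) (s : T ⟶ F.over),
    FactorsThrough s C.ideal → FactorsThrough (e ≫ homOver Φ + s) C.ideal

/-- A two-term complex `F₀ ⟶ F₁` of linear spaces, with `F₀ = F.left`, `F₁ = F.right` and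
differential `F.hom`. Morphisms `Φ` are commutative squares, with components `Φ₀ = Φ.left` and
`Φ₁ = Φ.right`. -/
abbrev TwoTermComplex (X : Scheme.{u}) := Arrow (Lin X)

/-- `Φ` induces an isomorphism on `H⁰`, the kernel of the differential in `Lin(X)`: the kernel
represents the kernel on `T`-valued points, so this says that `Φ₀` restricts to a bijection
`ker(F₀(T) → F₁(T)) → ker(E₀(T) → E₁(T))` for all `T`. -/
def IsoOnH0 {F E : TwoTermComplex X} (Φ : F ⟶ E) : Prop :=
  ∀ (T : Over X) (y : T ⟶ E.left.over), y ≫ homOver E.hom = 0 →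
    ∃! x : T ⟶ F.left.over, x ≫ homOver F.hom = 0 ∧ x ≫ homOver Φ.left = y

/-- A linear form `μ` on `L` over `U` vanishes on the `X`-scheme `Y` mapping to `L` by `g`. -/
def LinearForm.VanishesOn {L : LinearSpace X} {U : X.Opens} (μ : LinearForm L U) {Y : Over X}
    (g : Y ⟶ L.toOver) : Prop :=
  ∀ (T : Over X) (hT : LiesOver T U) (s : T ⟶ Y), μ.onPoints T hT (s ≫ g) = 0

/-- `Φ` induces a closed embedding on `H¹`. The cokernel `H¹(F)` of `F₀ ⟶ F₁` in `Lin(X)`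
corresponds to the sheaf of linear forms on `F₁` that vanish on `F₀`, and `H¹(F) ⟶ H¹(E)` is a
closed embedding of linear spaces if and only if the corresponding morphism of sheaves is an
epimorphism: every linear form on `F₁` that vanishes on `F₀` is locally the pull-back of a linear
form on `E₁` that vanishes on `E₀`. -/
def ClosedEmbeddingOnH1 {F E : TwoTermComplex X} (Φ : F ⟶ E) : Prop :=
  ∀ (U : X.Opens) (μ : LinearForm F.right.space U), μ.VanishesOn (homOver F.hom) →
    ∀ x ∈ U, ∃ V : X.Opens, x ∈ V ∧ V ≤ U ∧ ∃ ν : LinearForm E.right.space V,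
      ν.VanishesOn (homOver E.hom) ∧
      ∀ (T : Over X) (hV : LiesOver T V) (hU : LiesOver T U) (s : T ⟶ F.right.over),
        ν.onPoints T hV (s ≫ homOver Φ.right) = μ.onPoints T hU s

/-- Going down is applicable to `Φ : F ⟶ E`. -/
structure GoingDownApplicable {F E : TwoTermComplex X} (Φ : F ⟶ E) : Prop where
  isVectorBundle : F.left.space.IsVectorBundle
  isoOnH0 : IsoOnH0 Φ
  closedEmbeddingOnH1 : ClosedEmbeddingOnH1 Φ

/-- The `X`-scheme `E ⊕ F = E ×_X F`. -/
noncomputable def directSum (E F : Lin X) : Over X :=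
  Over.mk (Limits.pullback.fst E.over.hom F.over.hom ≫ E.over.hom)

/-- The first projection `E ⊕ F ⟶ E`. -/
noncomputable def directSum.fst (E F : Lin X) : directSum E F ⟶ E.over :=
  Over.homMk (Limits.pullback.fst E.over.hom F.over.hom)

/-- The second projection `E ⊕ F ⟶ F`. -/
noncomputable def directSum.snd (E F : Lin X) : directSum E F ⟶ F.over :=
  Over.homMk (Limits.pullback.snd E.over.hom F.over.hom) Limits.pullback.condition.symm

/-- The homomorphism `q = D ∘ pr₁ + Φ₁ ∘ pr₂ : E₀ ⊕ F₁ ⟶ E₁`, for `D` the differential of `E`. -/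
noncomputable def sumMap {F E : TwoTermComplex X} (Φ : F ⟶ E) :
    directSum E.left F.right ⟶ E.right.over :=
  directSum.fst E.left F.right ≫ homOver E.hom + directSum.snd E.left F.right ≫ homOver Φ.right

/-- The cone `C ⊆ E₁` is contained in the image of `q` in `Lin(X)`, the closed linear subspace of
`E₁` on which the linear forms `μ` with `μ ∘ q = 0` vanish. -/
def LinCone.IsInImage {F E : TwoTermComplex X} (Φ : F ⟶ E) (C : LinCone E.right) : Prop :=
  ∀ (U : X.Opens) (μ : LinearForm E.right.space U), μ.VanishesOn (sumMap Φ) →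
    ∀ (T : Over X) (hT : LiesOver T U) (s : T ⟶ E.right.over),
      FactorsThrough s C.ideal → μ.onPoints T hT s = 0

/-- The defining property of the push-forward `C'` of `C ⊆ F₁` by `Φ`: it is a cone in
`im q ⊆ E₁` with `q⁻¹(C') = E₀ ⊕ C` as closed subschemes of `E₀ ⊕ F₁`. -/
structure IsPushforward {F E : TwoTermComplex X} (Φ : F ⟶ E) (C : LinCone F.right)
    (C' : LinCone E.right) : Prop where
  isInImage : C'.IsInImage Φ
  preimage_eq : C'.ideal.comap (sumMap Φ).left =
    C.ideal.comap (directSum.snd E.left F.right).left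

open Classical in
/-- The push-forward `Φ_!(C)`: the cone with the defining property (a junk value if there is
none). -/
noncomputable def pushforward {F E : TwoTermComplex X} (Φ : F ⟶ E) (C : LinCone F.right) :
    LinCone E.right :=
  if h : ∃ C', IsPushforward Φ C C' then h.choose else LinCone.whole _

end LinearSpaces

/-! The proof works with points valued in arbitrary `X`-schemes `T`, locally on `X`. Write `q` for
the map `E₀ ⊕ F₁ ⟶ E₁`. The key fact (`GoingDownApplicable.exists_locally_exact`) is that `F₀ ⟶ E₀ ⊕
F₁ ⟶ E₁`, with first map `g ↦ (Φ₀ g, -D g)`, is locally split exact: points of `ker q` come from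
`F₀`, and points of the linear subspace `im q` lift to `E₀ ⊕ F₁`. Injectivity on `H⁰` makes `F₀ ⟶ E₀
⊕ F₁` a monomorphism, and since `F₀` is a vector bundle its coordinates extend to a local
retraction. The complementary projector kills `F₀`, and the remaining conditions on `H⁰` and `H¹`
let its coordinates descend to linear forms on `E₁`, which provide the lifts.

Consequently the push-forward of an `F₀`-cone `C` is its image in the naive sense: locally on `X`,
its points are exactly the `q(e, c)` with `c` in `C` (`IsImageCone`). Existence comes from the
scheme-theoretic image of `E₀ ⊕ C`, and uniqueness holds because a closed subscheme is determined by
its points. Functoriality is then the identity `q_Φ(e, q_Ψ(e', c)) = D_E(e + Φ₀ e') + Φ₁ Ψ₁ c`.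

The descent needs a duality between linear spaces and linear forms: over an affine open, a form that
vanishes on the common kernel of finitely many forms is a combination of them. It is obtained by
evaluating forms at a universal point with values in a square-zero extension. -/

namespace LinearSpaces

/-! ### Universal solutions of linear systems. -/

section SquareZero

/-- The square-zero extension of `R` by the cokernel of the transpose of `B` is universal, up to
scaling by a square-zero element, for solutions of the system of linear equations `B`. -/
theorem exists_squareZero_solution {R : Type u} [CommRing R] {n m : ℕ}
    (B : Matrix (Fin m) (Fin n) R) :
    ∃ (W : Type u) (_ : CommRing W) (i : R →+* W) (z : W →+* W) (v : Fin n → W),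
      z.comp i = i ∧ (∀ k, z (v k) = 0) ∧ (∀ j, ∑ k, i (B j k) * v k = 0) ∧
      (∀ c : Fin n → R, ∑ k, i (c k) * v k = 0 → ∃ r : Fin m → R, ∀ k, c k = ∑ j, r j * B j k) ∧
      (∀ x, z x = 0 → ∃ c : Fin n → R, x = ∑ k, i (c k) * v k) ∧
      ∀ (S : Type u) [CommRing S] (g : R →+* S) (w : Fin n → S),
        (∀ j, ∑ k, g (B j k) * w k = 0) →
        ∃ (S' : Type u) (_ : CommRing S') (ι : S →+* S') (ε : S') (f : W →+* S'),
          (∀ x y, ε * ι x = ε * ι y → x = y) ∧ f.comp i = ι.comp g ∧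
          ∀ k, f (v k) = ε * ι (w k) := by
  classical
  -- `N` is the row space. `R ⊕ M` truncates `Sym M`, the coordinate ring of the solution space, in
  -- degree one, and the classes of the basis vectors solve the system tautologically.
  let N : Submodule R (Fin n → R) := Submodule.span R (Set.range B)
  let M := (Fin n → R) ⧸ N
  have key : ∀ c : Fin n → R, ∑ k, (TrivSqZeroExt.inl (c k) : TrivSqZeroExt R M) *
      TrivSqZeroExt.inr (N.mkQ (Pi.single k 1)) = TrivSqZeroExt.inr (N.mkQ c) := by
    intro c
    have : c = ∑ k, c k • Pi.single k (1 : R) := by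
      ext l; simp [Finset.sum_apply, Pi.single_apply]
    conv_rhs => rw [this]
    rw [map_sum]
    refine Eq.trans ?_ (map_sum (TrivSqZeroExt.inrHom R M) _ _).symm
    refine Finset.sum_congr rfl fun k _ => ?_
    rw [TrivSqZeroExt.inl_mul_inr, map_smul]
    rfl
  refine ⟨TrivSqZeroExt R M, inferInstance, TrivSqZeroExt.inlHom R M,
    (TrivSqZeroExt.inlHom R M).comp (TrivSqZeroExt.fstHom R R M).toRingHom,
    fun k => TrivSqZeroExt.inr (N.mkQ (Pi.single k 1)), ?_, ?_, ?_, ?_, ?_, ?_⟩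
  · ext x <;> simp
  · intro k; simp
  · intro j
    refine (key (B j)).trans ?_
    rw [(N.mkQ_apply _), (Submodule.Quotient.mk_eq_zero N).2 (Submodule.subset_span ⟨j, rfl⟩)]
    simp
  · intro c hc
    have h1 : N.mkQ c = 0 := by
      have := (key c).symm.trans hc
      simpa using congrArg TrivSqZeroExt.snd this
    rw [N.mkQ_apply, Submodule.Quotient.mk_eq_zero] at h1
    obtain ⟨r, hr⟩ := (Submodule.mem_span_range_iff_exists_fun R).1 h1
    exact ⟨r, fun k => by rw [← hr]; simp [Finset.sum_apply]⟩
  · intro x hx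
    obtain ⟨c, hc⟩ := N.mkQ_surjective x.snd
    refine ⟨c, ?_⟩
    refine Eq.trans ?_ (key c).symm
    have hx' : x.fst = 0 := by simpa using congrArg TrivSqZeroExt.fst hx
    rw [hc]
    ext
    · simpa using hx'
    · simp
  · intro S _ g w hw
    let _ : Algebra R S := g.toAlgebra
    let q : M →ₗ[R] S := N.liftQ (∑ k, (LinearMap.proj k : (Fin n → R) →ₗ[R] R).smulRight (w k)) (by
      rw [Submodule.span_le]
      rintro _ ⟨j, rfl⟩
      simpa [Algebra.smul_def, RingHom.algebraMap_toAlgebra] using hw j)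
    -- Products of the `w k` need not vanish, so `v k ↦ w k` need not define a ring map on `W`.
    -- After scaling by the dual number `ε` the products vanish, and `ε` can still be cancelled
    -- against elements of `S`.
    refine ⟨DualNumber S, inferInstance, TrivSqZeroExt.inlHom S S, TrivSqZeroExt.inr 1,
      (TrivSqZeroExt.lift (S := R) (A := DualNumber S)
      (Algebra.ofId R _) ((TrivSqZeroExt.inrHom S S).restrictScalars R ∘ₗ q)
      (fun x y => by simp) (fun r x => ?_) (fun r x => ?_)).toRingHom, ?_, ?_, ?_⟩
    · simp [Algebra.ofId_apply, Algebra.smul_def]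
      trace_state
    · simp [Algebra.ofId_apply, Algebra.smul_def, mul_comm]
    · intro x y hxy
      simpa using congrArg TrivSqZeroExt.snd hxy
    · ext r <;> simp [TrivSqZeroExt.algebraMap_eq_inl', RingHom.algebraMap_toAlgebra]
    · intro k
      have hq : q (N.mkQ (Pi.single k 1)) = w k := by
        rw [Submodule.mkQ_apply, Submodule.liftQ_apply]
        simp [LinearMap.sum_apply, Pi.single_apply]
      refine (TrivSqZeroExt.lift_apply_inr _ _ _ _ _ _).trans ?_
      change (TrivSqZeroExt.inr (q (N.mkQ (Pi.single k 1))) : DualNumber S) = _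
      rw [hq]
      ext <;> simp

end SquareZero

/-! ### Scalars, and points valued in spectra over an affine open. -/

section Scalars

variable {X : Scheme.{u}}

theorem LiesOver.mono {T : Over X} {V U : X.Opens} (h : LiesOver T V) (hVU : V ≤ U) :
    LiesOver T U := le_trans h ((TopologicalSpace.Opens.map T.hom.base).monotone hVU)

theorem LiesOver.comp {T' T : Over X} {U : X.Opens} (h : LiesOver T U) (f : T' ⟶ T) :
    LiesOver T' U := by
  intro x _
  have := h (x := f.left x) trivial
  rw [← Over.w f]
  exact this

/-- Sections over `U` as scalars on a scheme over `U`. -/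
noncomputable def scalar {T : Over X} {U : X.Opens} (hT : LiesOver T U) :
    Γ(X, U) →+* Γ(T.left, ⊤) := (T.hom.appLE U ⊤ hT).hom

theorem appLE_top_comp_appTop {Y' Y Z : Scheme.{u}} (f : Y' ⟶ Y) (g : Y ⟶ Z) (h : Y' ⟶ Z)
    (w : f ≫ g = h) (U : Z.Opens) (e : ⊤ ≤ g ⁻¹ᵁ U) (e' : ⊤ ≤ h ⁻¹ᵁ U) :
    g.appLE U ⊤ e ≫ f.appTop = h.appLE U ⊤ e' := by
  subst w
  have h : f.appTop = f.appLE ⊤ ⊤ le_rfl := Scheme.Hom.app_eq_appLE f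
  rw [h]
  exact Scheme.Hom.appLE_comp_appLE f g U ⊤ ⊤ e le_rfl

theorem toSpecΓ_SpecMap_appLE_fromSpec {Y Z : Scheme.{u}} (g : Y ⟶ Z) {V : Z.Opens}
    (hV : IsAffineOpen V) (e : ⊤ ≤ g ⁻¹ᵁ V) :
    Y.toSpecΓ ≫ Spec.map (g.appLE V ⊤ e) ≫ hV.fromSpec = g := by
  have h := Scheme.Opens.toSpecΓ_SpecMap_appLE_assoc g V ⊤ e hV.fromSpec
  rw [hV.toSpecΓ_fromSpec, Scheme.Hom.resLE_comp_ι, Scheme.Opens.toSpecΓ_top,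
    Category.assoc] at h
  have : IsIso (⊤ : Y.Opens).ι := inferInstanceAs (IsIso Y.topIso.hom)
  exact (cancel_epi _).1 h

theorem appTop_scalar {T' T : Over X} {U : X.Opens} (hT : LiesOver T U) (f : T' ⟶ T)
    (hT' : LiesOver T' U) (a : Γ(X, U)) :
    f.left.appTop (scalar hT a) = scalar hT' a := by
  exact congr($(appLE_top_comp_appTop f.left T.hom T'.hom (Over.w f) U hT hT') a)

theorem scalar_map {T : Over X} {V U : X.Opens} (hT : LiesOver T V) (hVU : V ≤ U) (a : Γ(X, U)) :
    scalar hT (X.presheaf.map (homOfLE hVU).op a) = scalar (hT.mono hVU) a := by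
  have := Scheme.Hom.map_appLE T.hom hT (homOfLE hVU).op
  exact congr($this a)

/-- The spectrum of an algebra over the sections on an affine open subscheme. -/
noncomputable def specOver {V : X.Opens} (hV : IsAffineOpen V) {S : Type u} [CommRing S]
    (g : Γ(X, V) →+* S) : Over X :=
  Over.mk (Spec.map (CommRingCat.ofHom g) ≫ hV.fromSpec)

theorem liesOver_specOver {V : X.Opens} (hV : IsAffineOpen V) {S : Type u} [CommRing S]
    (g : Γ(X, V) →+* S) : LiesOver (specOver hV g) V := by
  intro x _
  have : hV.fromSpec (Spec.map (CommRingCat.ofHom g) x) ∈ Set.range hV.fromSpec := ⟨_, rfl⟩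
  rw [hV.range_fromSpec] at this
  exact this

/-- The global sections of `Spec S`. -/
noncomputable def ofRing {V : X.Opens} (hV : IsAffineOpen V) {S : Type u} [CommRing S]
    (g : Γ(X, V) →+* S) : S ≃+* Γ((specOver hV g).left, ⊤) :=
  (Scheme.ΓSpecIso (CommRingCat.of S)).symm.commRingCatIsoToRingEquiv

theorem scalar_specOver {V : X.Opens} (hV : IsAffineOpen V) {S : Type u} [CommRing S]
    (g : Γ(X, V) →+* S) (a : Γ(X, V)) :
    scalar (liesOver_specOver hV g) a = ofRing hV g (g a) := by
  have : (Spec.map (CommRingCat.ofHom g) ≫ hV.fromSpec).appLE V ⊤ (liesOver_specOver hV g) =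
      CommRingCat.ofHom g ≫ (Scheme.ΓSpecIso (CommRingCat.of S)).inv := by
    refine (appLE_top_comp_appTop (Spec.map (CommRingCat.ofHom g)) hV.fromSpec _ rfl V
      (by rw [hV.fromSpec_preimage_self]) _).symm.trans ?_
    rw [Scheme.ΓSpecIso_inv_naturality, Scheme.Hom.appLE,
      hV.fromSpec_app_self]
    simp only [Category.assoc]
    congr 1
  exact congr($this a)

/-- Ring homomorphisms compatible with the scalars give morphisms over `X`. -/
noncomputable def specOverMap {V : X.Opens} (hV : IsAffineOpen V) {S S' : Type u} [CommRing S]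
    [CommRing S'] (g : Γ(X, V) →+* S) (g' : Γ(X, V) →+* S') (f : S →+* S') (hf : f.comp g = g') :
    specOver hV g' ⟶ specOver hV g :=
  Over.homMk (Spec.map (CommRingCat.ofHom f)) (by
    subst hf
    simp [specOver])

theorem specOverMap_appTop {V : X.Opens} (hV : IsAffineOpen V) {S S' : Type u} [CommRing S]
    [CommRing S'] (g : Γ(X, V) →+* S) (g' : Γ(X, V) →+* S') (f : S →+* S') (hf : f.comp g = g')
    (x : S) :
    (specOverMap hV g g' f hf).left.appTop (ofRing hV g x) = ofRing hV g' (f x) := by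
  have := Scheme.ΓSpecIso_inv_naturality (CommRingCat.ofHom f)
  exact congr($this x).symm

/-- A scheme over an affine open subscheme maps to the spectrum of its global sections. -/
noncomputable def toSpecOver {V : X.Opens} (hV : IsAffineOpen V) {T : Over X} (hT : LiesOver T V) :
    T ⟶ specOver hV (scalar hT) :=
  Over.homMk T.left.toSpecΓ (by
    exact toSpecΓ_SpecMap_appLE_fromSpec T.hom hV hT)

theorem toSpecOver_appTop {V : X.Opens} (hV : IsAffineOpen V) {T : Over X} (hT : LiesOver T V)
    (x : Γ(T.left, ⊤)) :
    (toSpecOver hV hT).left.appTop (ofRing hV (scalar hT) x) = x := by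
  have : (Scheme.ΓSpecIso Γ(T.left, ⊤)).inv ≫ T.left.toSpecΓ.appTop = 𝟙 _ := by
    rw [Scheme.toSpecΓ_appTop, Iso.inv_hom_id]
  exact congr($this x)

attribute [irreducible] specOver specOverMap ofRing toSpecOver

end Scalars

/-! ### Linear forms on a presented linear space. -/

section LinearForms

variable {X : Scheme.{u}} {L M : LinearSpace X} {U V : X.Opens}

theorem LinearSpace.comp_zero (L : LinearSpace X) {T' T : Over X} (f : T' ⟶ T) :
    f ≫ (0 : T ⟶ L.toOver) = 0 := by
  have := L.comp_add f 0 0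
  simpa using this

/-- The action of a homomorphism of linear spaces on `T`-valued points. -/
def LinearHom.onPoints (f : LinearHom L M) (T : Over X) :
    (T ⟶ L.toOver) →ₗ[Γ(T.left, ⊤)] (T ⟶ M.toOver) where
  toFun s := s ≫ f.toHom
  map_add' := f.map_add
  map_smul' := f.map_smul

theorem LinearHom.zero_comp (f : LinearHom L M) (T : Over X) :
    (0 : T ⟶ L.toOver) ≫ f.toHom = 0 := (f.onPoints T).map_zero

theorem LinearHom.sub_comp (f : LinearHom L M) {T : Over X} (s t : T ⟶ L.toOver) :
    (s - t) ≫ f.toHom = s ≫ f.toHom - t ≫ f.toHom := (f.onPoints T).map_sub s t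

namespace LinearForm

/-- The restriction of a linear form to a smaller open subscheme. -/
def res (φ : LinearForm L U) (h : V ≤ U) : LinearForm L V where
  onPoints T hT := φ.onPoints T (hT.mono h)
  naturality hT' hT f s := φ.naturality (hT'.mono h) (hT.mono h) f s

/-- The pull-back of a linear form by a homomorphism. -/
def comp (φ : LinearForm M U) (f : LinearHom L M) : LinearForm L U where
  onPoints T hT := (φ.onPoints T hT).comp (f.onPoints T)
  naturality hT' hT g s := by
    refine Eq.trans ?_ (φ.naturality hT' hT g (s ≫ f.toHom))
    rw [← Category.assoc]
    rfl

@[simp]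
theorem comp_onPoints (φ : LinearForm M U) (f : LinearHom L M) (T : Over X) (hT : LiesOver T U)
    (s : T ⟶ L.toOver) : (φ.comp f).onPoints T hT s = φ.onPoints T hT (s ≫ f.toHom) := rfl

/-- The sum of two linear forms. -/
def add (φ ψ : LinearForm L U) : LinearForm L U where
  onPoints T hT := φ.onPoints T hT + ψ.onPoints T hT
  naturality hT' hT f s := by simp [φ.naturality hT' hT, ψ.naturality hT' hT]

@[simp]
theorem add_onPoints (φ ψ : LinearForm L U) (T : Over X) (hT : LiesOver T U)
    (s : T ⟶ L.toOver) :
    (φ.add ψ).onPoints T hT s = φ.onPoints T hT s + ψ.onPoints T hT s := rfl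

/-- The difference of two linear forms. -/
def sub (φ ψ : LinearForm L U) : LinearForm L U where
  onPoints T hT := φ.onPoints T hT - ψ.onPoints T hT
  naturality hT' hT f s := by simp [φ.naturality hT' hT, ψ.naturality hT' hT]

@[simp]
theorem sub_onPoints (φ ψ : LinearForm L U) (T : Over X) (hT : LiesOver T U)
    (s : T ⟶ L.toOver) :
    (φ.sub ψ).onPoints T hT s = φ.onPoints T hT s - ψ.onPoints T hT s := rfl

/-- A linear combination of linear forms with coefficients in the sections over `U`. -/
noncomputable def combination {n : ℕ} (a : Fin n → Γ(X, U)) (φ : Fin n → LinearForm L U) :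
    LinearForm L U where
  onPoints T hT := ∑ i, scalar hT (a i) • (φ i).onPoints T hT
  naturality hT' hT f s := by
    simp [LinearMap.sum_apply, (φ _).naturality hT' hT, appTop_scalar hT f hT']

@[simp]
theorem combination_onPoints {n : ℕ} (a : Fin n → Γ(X, U)) (φ : Fin n → LinearForm L U)
    (T : Over X) (hT : LiesOver T U) (s : T ⟶ L.toOver) :
    (combination a φ).onPoints T hT s = ∑ i, scalar hT (a i) * (φ i).onPoints T hT s := by
  simp [combination, LinearMap.sum_apply]

theorem onPoints_specOverMap (φ : LinearForm L U) (hU : IsAffineOpen U) {S S' : Type u}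
    [CommRing S] [CommRing S'] {g : Γ(X, U) →+* S} {g' : Γ(X, U) →+* S'} (f : S →+* S')
    (hf : f.comp g = g') {s : specOver hU g ⟶ L.toOver} {x : S}
    (hx : φ.onPoints _ (liesOver_specOver hU g) s = ofRing hU g x) :
    φ.onPoints _ (liesOver_specOver hU g') (specOverMap hU g g' f hf ≫ s) =
      ofRing hU g' (f x) := by
  refine (φ.naturality _ (liesOver_specOver hU g) _ _).trans ?_
  rw [hx]
  exact specOverMap_appTop hU g g' f hf x

end LinearForm

/-- The linear forms `ℓ` embed `L|_U` into `𝔸ⁿ_U` as the kernel of the matrix `A`. -/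
def IsPresentedBy (L : LinearSpace X) (U : X.Opens) {n m : ℕ} (ℓ : Fin n → LinearForm L U)
    (A : Matrix (Fin m) (Fin n) Γ(X, U)) : Prop :=
  ∀ (T : Over X) (hT : LiesOver T U),
    Function.Injective (fun (s : T ⟶ L.toOver) (i : Fin n) => (ℓ i).onPoints T hT s) ∧
    Set.range (fun (s : T ⟶ L.toOver) (i : Fin n) => (ℓ i).onPoints T hT s) =
      {v : Fin n → Γ(T.left, ⊤) | ∀ j, ∑ i, scalar hT (A j i) * v i = 0}

namespace IsPresentedBy

variable {n m : ℕ} {ℓ : Fin n → LinearForm L U} {A : Matrix (Fin m) (Fin n) Γ(X, U)}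

theorem ext (h : IsPresentedBy L U ℓ A) {T : Over X} (hT : LiesOver T U) {s t : T ⟶ L.toOver}
    (hst : ∀ i, (ℓ i).onPoints T hT s = (ℓ i).onPoints T hT t) : s = t :=
  (h T hT).1 (funext hst)

theorem relation (h : IsPresentedBy L U ℓ A) {T : Over X} (hT : LiesOver T U) (s : T ⟶ L.toOver)
    (j : Fin m) : ∑ i, scalar hT (A j i) * (ℓ i).onPoints T hT s = 0 := by
  have : (fun i => (ℓ i).onPoints T hT s) ∈ {v : Fin n → Γ(T.left, ⊤) |
      ∀ j, ∑ i, scalar hT (A j i) * v i = 0} := (h T hT).2 ▸ ⟨s, rfl⟩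
  exact this j

theorem exists_point (h : IsPresentedBy L U ℓ A) {T : Over X} (hT : LiesOver T U)
    (v : Fin n → Γ(T.left, ⊤)) (hv : ∀ j, ∑ i, scalar hT (A j i) * v i = 0) :
    ∃ s : T ⟶ L.toOver, ∀ i, (ℓ i).onPoints T hT s = v i := by
  obtain ⟨s, hs⟩ : v ∈ Set.range (fun (s : T ⟶ L.toOver) (i : Fin n) =>
    (ℓ i).onPoints T hT s) := (h T hT).2 ▸ hv
  exact ⟨s, fun i => congrFun hs i⟩

theorem res (h : IsPresentedBy L U ℓ A) (hVU : V ≤ U) :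
    IsPresentedBy L V (fun i => (ℓ i).res hVU)
      (A.map (X.presheaf.map (homOfLE hVU).op)) := by
  intro T hT
  simp only [Matrix.map_apply, scalar_map hT hVU]
  exact h T (hT.mono hVU)

/-- Over an affine open subscheme, every linear form is a linear combination of the coordinates. -/
theorem exists_combination (h : IsPresentedBy L U ℓ A) (hU : IsAffineOpen U)
    (φ : LinearForm L U) : ∃ c : Fin n → Γ(X, U), ∀ (T : Over X) (hT : LiesOver T U)
      (s : T ⟶ L.toOver), φ.onPoints T hT s = ∑ k, scalar hT (c k) * (ℓ k).onPoints T hT s := by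
  obtain ⟨W, _, i, z, v, hzi, hzv, hv, -, hz, hW⟩ := exists_squareZero_solution A
  obtain ⟨s₀, hs₀⟩ := h.exists_point (liesOver_specOver hU i) (fun k => ofRing hU i (v k))
    (fun j => by simp only [scalar_specOver, ← map_mul, ← map_sum, hv, map_zero])
  obtain ⟨x, hx⟩ := (ofRing hU i).surjective (φ.onPoints _ (liesOver_specOver hU i) s₀)
  -- `z` scales the universal point `s₀` by zero, so the value `x` of `φ` there has no degree-zero
  -- part and is a combination of the `v k`. Its coefficients are the desired ones.
  have hzx : z x = 0 := by
    have h0 : specOverMap hU i i z hzi ≫ s₀ = 0 := by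
      apply h.ext (liesOver_specOver hU i)
      intro k
      rw [(ℓ k).onPoints_specOverMap hU z hzi (hs₀ k), hzv, map_zero, map_zero]
    have := φ.onPoints_specOverMap hU z hzi hx.symm
    rw [h0, map_zero] at this
    exact (map_eq_zero_iff _ (ofRing hU i).injective).1 this.symm
  obtain ⟨c, hc⟩ := hz x hzx
  refine ⟨c, fun T hT s => ?_⟩
  set w : Fin n → Γ(T.left, ⊤) := fun k => (ℓ k).onPoints T hT s with hw
  have hwA : ∀ j, ∑ k, scalar hT (A j k) * w k = 0 := h.relation hT s
  -- A point is determined by its coordinates, which are global functions on `T`, so it factors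
  -- through the spectrum of the global sections.
  obtain ⟨s₁, hs₁⟩ := h.exists_point (liesOver_specOver hU (scalar hT))
    (fun k => ofRing hU (scalar hT) (w k))
    (fun j => by simp only [scalar_specOver, ← map_mul, ← map_sum, hwA, map_zero])
  have hs : toSpecOver hU hT ≫ s₁ = s := by
    apply h.ext hT
    intro k
    rw [(ℓ k).naturality _ (liesOver_specOver hU _), hs₁, toSpecOver_appTop]
  obtain ⟨y, hy⟩ := (ofRing hU (scalar hT)).surjective
    (φ.onPoints _ (liesOver_specOver hU (scalar hT)) s₁)
  have hsy : φ.onPoints T hT s = y := by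
    rw [← hs, φ.naturality _ (liesOver_specOver hU _), ← hy, toSpecOver_appTop]
  obtain ⟨S', _, ι, ε, f, hε, hfi, hfv⟩ := hW Γ(T.left, ⊤) (scalar hT) w hwA
  obtain ⟨g, hg⟩ : ∃ g, ι.comp (scalar hT) = g := ⟨_, rfl⟩
  rw [hg] at hfi
  -- The universal point specializes to `ε • s₁`. Linearity of `φ` then determines `ε` times its
  -- value at `s₁`, and `ε` is cancelled.
  have hpt : specOverMap hU i g f hfi ≫ s₀ =
      ofRing hU g ε • (specOverMap hU (scalar hT) g ι hg ≫ s₁) := by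
    apply h.ext (liesOver_specOver hU g)
    intro k
    rw [map_smul, (ℓ k).onPoints_specOverMap hU _ hg (hs₁ k),
      (ℓ k).onPoints_specOverMap hU f hfi (hs₀ k), hfv, map_mul, smul_eq_mul]
  have := congrArg (φ.onPoints _ (liesOver_specOver hU g)) hpt
  rw [map_smul, φ.onPoints_specOverMap hU _ hg hy.symm,
    φ.onPoints_specOverMap hU f hfi hx.symm, smul_eq_mul, ← map_mul] at this
  have := (ofRing hU g).injective this
  have hfc : ∀ a, f (i a) = ι (scalar hT a) := fun a => by
    have : ι (scalar hT a) = g a := congr($hg a)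
    rw [this]
    exact congr($hfi a)
  rw [hsy]
  refine hε _ _ (this.symm.trans ?_)
  simp only [hc, map_sum, map_mul, hfc, hfv, Finset.mul_sum]
  exact Finset.sum_congr rfl fun k _ => mul_left_comm _ _ _

/-- Over an affine open subscheme, a linear form that vanishes on the common kernel of some linear
forms is a linear combination of them. -/
theorem exists_combination_of_vanishing (h : IsPresentedBy L U ℓ A) (hU : IsAffineOpen U) {p : ℕ}
    (θ : Fin p → LinearForm L U) (φ : LinearForm L U)
    (hφ : ∀ (T : Over X) (hT : LiesOver T U) (s : T ⟶ L.toOver),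
      (∀ l, (θ l).onPoints T hT s = 0) → φ.onPoints T hT s = 0) :
    ∃ c : Fin p → Γ(X, U), ∀ (T : Over X) (hT : LiesOver T U)
      (s : T ⟶ L.toOver), φ.onPoints T hT s = ∑ l, scalar hT (c l) * (θ l).onPoints T hT s := by
  choose d hd using fun l => h.exists_combination hU (θ l)
  obtain ⟨a, ha⟩ := h.exists_combination hU φ
  -- The equations of `L` are stacked on those of the `θ l`, so the universal solution is a point of
  -- the common kernel. Vanishing of `φ` there puts its coefficients in the row space, and the rows
  -- of `A` contribute zero on `L`.
  obtain ⟨W, _, i, z, v, -, -, hv, hrow, -, -⟩ :=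
    exists_squareZero_solution (Matrix.of (Fin.append (fun j => A j) d))
  obtain ⟨s₀, hs₀⟩ := h.exists_point (liesOver_specOver hU i) (fun k => ofRing hU i (v k))
    (fun j => by
      have := hv (Fin.castAdd p j)
      simp only [Matrix.of_apply, Fin.append_left] at this
      simp only [scalar_specOver, ← map_mul, ← map_sum, this, map_zero])
  have h0 := hφ _ (liesOver_specOver hU i) s₀ (fun l => by
    have := hv (Fin.natAdd m l)
    simp only [Matrix.of_apply, Fin.append_right] at this
    simp only [hd, hs₀, scalar_specOver, ← map_mul, ← map_sum, this, map_zero])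
  simp only [ha, hs₀, scalar_specOver, ← map_mul, ← map_sum] at h0
  obtain ⟨r, hr⟩ := hrow a ((map_eq_zero_iff _ (ofRing hU i).injective).1 h0)
  refine ⟨fun l => r (Fin.natAdd m l), fun T hT s => ?_⟩
  simp only [ha, hr, Matrix.of_apply, Fin.sum_univ_add, Fin.append_left, Fin.append_right, map_add,
    map_sum, map_mul, add_mul, Finset.sum_add_distrib, hd, Finset.sum_mul, Finset.mul_sum,
    mul_assoc]
  rw [Finset.sum_comm, Finset.sum_comm (γ := Fin p)]
  simp only [← Finset.mul_sum, h.relation hT s, mul_zero, Finset.sum_const_zero, zero_add]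

end IsPresentedBy

end LinearForms

/-! ### Local split exactness of `F₀ ⟶ E₀ ⊕ F₁ ⟶ E₁`. -/

section Splitting

variable {X : Scheme.{u}}

theorem exists_affine_le (x : X) {U : X.Opens} (hx : x ∈ U) :
    ∃ V : X.Opens, IsAffineOpen V ∧ x ∈ V ∧ V ≤ U := by
  obtain ⟨_, ⟨V, hV, rfl⟩, hxV, hVU⟩ :=
    X.isBasis_affineOpens.exists_subset_of_mem_open hx U.isOpen
  exact ⟨V, hV, hxV, hVU⟩

theorem exists_le_of_finite {ι : Type*} [Finite ι] (x : X) (V : ι → X.Opens)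
    (hx : ∀ i, x ∈ V i) : ∃ W : X.Opens, x ∈ W ∧ ∀ i, W ≤ V i :=
  ⟨⟨⋂ i, V i, isOpen_iInter_of_finite fun i => (V i).isOpen⟩, Set.mem_iInter.2 hx,
    fun i => Set.iInter_subset _ i⟩

theorem Lin.exists_isPresentedBy (L : Lin X) (x : X) :
    ∃ U : X.Opens, x ∈ U ∧ ∃ (n m : ℕ) (ℓ : Fin n → LinearForm L.space U)
      (A : Matrix (Fin m) (Fin n) Γ(X, U)), IsPresentedBy L.space U ℓ A :=
  L.isRepresentable x

theorem LinearSpace.IsVectorBundle.exists_isPresentedBy {L : LinearSpace X} (h : L.IsVectorBundle)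
    (x : X) : ∃ U : X.Opens, x ∈ U ∧ ∃ (n : ℕ) (ℓ : Fin n → LinearForm L U),
      IsPresentedBy L U ℓ (0 : Matrix (Fin 0) (Fin n) Γ(X, U)) := by
  obtain ⟨U, hx, n, ℓ, hℓ⟩ := h x
  refine ⟨U, hx, n, ℓ, fun T hT => ⟨(hℓ T hT).1, ?_⟩⟩
  rw [(hℓ T hT).2.range_eq]
  exact (Set.eq_univ_of_forall fun v j => j.elim0).symm

variable {F E : TwoTermComplex X} (Φ : F ⟶ E)

theorem comp_square {T : Over X} (g : T ⟶ F.left.over) :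
    (g ≫ homOver Φ.left) ≫ homOver E.hom = (g ≫ homOver F.hom) ≫ homOver Φ.right := by
  have h : homOver Φ.left ≫ homOver E.hom = homOver F.hom ≫ homOver Φ.right :=
    congrArg homOver (Arrow.w Φ)
  rw [Category.assoc, h, Category.assoc]

variable {Φ}

theorem IsoOnH0.eq_zero (h : IsoOnH0 Φ) {T : Over X} (g : T ⟶ F.left.over)
    (h0 : g ≫ homOver Φ.left = 0) (h1 : g ≫ homOver F.hom = 0) : g = 0 :=
  (h T 0 (LinearHom.zero_comp E.hom T)).unique ⟨h1, h0⟩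
    ⟨LinearHom.zero_comp F.hom T, LinearHom.zero_comp Φ.left T⟩

/-- Linear forms on `E₀` and `F₁` that agree on `F₀` come locally from a linear form on `E₁`. -/
theorem GoingDownApplicable.exists_form (hΦ : GoingDownApplicable Φ) {U : X.Opens}
    (hU : IsAffineOpen U) {x : X} (hx : x ∈ U) {n m p q : ℕ}
    {ℓ : Fin n → LinearForm E.left.space U} {A : Matrix (Fin m) (Fin n) Γ(X, U)}
    (hℓ : IsPresentedBy E.left.space U ℓ A)
    {ξ : Fin p → LinearForm E.right.space U} {B : Matrix (Fin q) (Fin p) Γ(X, U)}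
    (hξ : IsPresentedBy E.right.space U ξ B)
    (α : LinearForm E.left.space U) (β : LinearForm F.right.space U)
    (hαβ : ∀ (T : Over X) (hT : LiesOver T U) (g : T ⟶ F.left.over),
      α.onPoints T hT (g ≫ homOver Φ.left) = β.onPoints T hT (g ≫ homOver F.hom)) :
    ∃ V : X.Opens, x ∈ V ∧ ∃ (hVU : V ≤ U) (ν : LinearForm E.right.space V),
      ∀ (T : Over X) (hT : LiesOver T V),
        (∀ e : T ⟶ E.left.over, ν.onPoints T hT (e ≫ homOver E.hom) =
          α.onPoints T (hT.mono hVU) e) ∧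
        ∀ f : T ⟶ F.right.over, ν.onPoints T hT (f ≫ homOver Φ.right) =
          β.onPoints T (hT.mono hVU) f := by
  -- By the `H⁰` condition, a point of `ker D_E` comes from a point of `ker D_F`, where `α` agrees
  -- with `β` and hence vanishes. So `α` extends along `D_E` to a form on `E₁`.
  obtain ⟨c, hc⟩ := hℓ.exists_combination_of_vanishing hU (fun l => (ξ l).comp E.hom) α
    (fun T hT s hs => by
      have h0 : s ≫ homOver E.hom = 0 := hξ.ext hT fun i => by
        rw [map_zero]; exact hs i
      obtain ⟨g, ⟨hg, rfl⟩, -⟩ := hΦ.isoOnH0 T s h0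
      rw [hαβ, hg, map_zero])
  have hν₀ : ∀ (T : Over X) (hT : LiesOver T U) (e : T ⟶ E.left.over),
      (LinearForm.combination c ξ).onPoints T hT (e ≫ homOver E.hom) = α.onPoints T hT e := by
    intro T hT e
    rw [hc, LinearForm.combination_onPoints]
    rfl
  -- The error of this extension on `F₁` vanishes on `F₀`. The `H¹` condition corrects it without
  -- changing the restriction to `E₀`.
  obtain ⟨V, hxV, hVU, ν, hν0, hν⟩ := hΦ.closedEmbeddingOnH1 U
    (β.sub ((LinearForm.combination c ξ).comp Φ.right)) (fun T hT s => by
      have := hν₀ T hT (s ≫ homOver Φ.left)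
      rw [comp_square, hαβ] at this
      rw [LinearForm.sub_onPoints, sub_eq_zero]
      exact this.symm) x hx
  refine ⟨V, hxV, hVU, ((LinearForm.combination c ξ).res hVU).add ν, fun T hT => ⟨?_, ?_⟩⟩
  · intro e
    rw [LinearForm.add_onPoints, hν0 T hT e, add_zero]
    exact hν₀ T (hT.mono hVU) e
  · intro f
    rw [LinearForm.add_onPoints, hν T hT (hT.mono hVU) f, LinearForm.sub_onPoints]
    exact add_sub_cancel _ _

/-- Locally, the coordinates on `E₀ ⊕ F₁`, projected along `F₀`, descend to linear forms on
`E₁`. -/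
theorem GoingDownApplicable.exists_descended_coordinates (hΦ : GoingDownApplicable Φ) (x : X) :
    ∃ V : X.Opens, x ∈ V ∧ IsAffineOpen V ∧ ∃ (n₀ m₀ n₁ m₁ p q : ℕ)
      (ℓ₀ : Fin n₀ → LinearForm E.left.space V) (A₀ : Matrix (Fin m₀) (Fin n₀) Γ(X, V))
      (ℓ₁ : Fin n₁ → LinearForm F.right.space V) (A₁ : Matrix (Fin m₁) (Fin n₁) Γ(X, V))
      (ξ : Fin p → LinearForm E.right.space V) (B : Matrix (Fin q) (Fin p) Γ(X, V))
      (ν₀ : Fin n₀ → LinearForm E.right.space V) (ν₁ : Fin n₁ → LinearForm E.right.space V),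
      IsPresentedBy E.left.space V ℓ₀ A₀ ∧ IsPresentedBy F.right.space V ℓ₁ A₁ ∧
      IsPresentedBy E.right.space V ξ B ∧
      ∀ (T : Over X) (hT : LiesOver T V) (e : T ⟶ E.left.over) (f : T ⟶ F.right.over),
        ∃ g : T ⟶ F.left.over,
          (∀ k, (ν₀ k).onPoints T hT (e ≫ homOver E.hom + f ≫ homOver Φ.right) =
            (ℓ₀ k).onPoints T hT (e - g ≫ homOver Φ.left)) ∧
          ∀ k, (ν₁ k).onPoints T hT (e ≫ homOver E.hom + f ≫ homOver Φ.right) =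
            (ℓ₁ k).onPoints T hT (f + g ≫ homOver F.hom) := by
  obtain ⟨U₀, hx₀, n₀, m₀, ℓ₀, A₀, hℓ₀⟩ := E.left.exists_isPresentedBy x
  obtain ⟨U₁, hx₁, n₁, m₁, ℓ₁, A₁, hℓ₁⟩ := F.right.exists_isPresentedBy x
  obtain ⟨U₂, hx₂, p, q, ξ, B, hξ⟩ := E.right.exists_isPresentedBy x
  obtain ⟨U₃, hx₃, r, η, hη⟩ := hΦ.isVectorBundle.exists_isPresentedBy x
  obtain ⟨U, hU, hxU, hle⟩ := exists_affine_le x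
    (show x ∈ U₀ ⊓ U₁ ⊓ (U₂ ⊓ U₃) from ⟨⟨hx₀, hx₁⟩, ⟨hx₂, hx₃⟩⟩)
  replace hℓ₀ := hℓ₀.res (hle.trans (inf_le_left.trans inf_le_left))
  replace hℓ₁ := hℓ₁.res (hle.trans (inf_le_left.trans inf_le_right))
  replace hξ := hξ.res (hle.trans (inf_le_right.trans inf_le_left))
  replace hη := hη.res (hle.trans (inf_le_right.trans inf_le_right))
  generalize (fun i => (ℓ₀ i).res _) = ℓ₀ at hℓ₀
  generalize (fun i => (ℓ₁ i).res _) = ℓ₁ at hℓ₁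
  generalize (fun i => (ξ i).res _) = ξ at hξ
  generalize (fun i => (η i).res _) = η at hη
  generalize A₀.map _ = A₀ at hℓ₀
  generalize A₁.map _ = A₁ at hℓ₁
  generalize B.map _ = B at hξ
  choose c₀ hc₀ using fun k => hη.exists_combination hU ((ℓ₀ k).comp Φ.left)
  choose c₁ hc₁ using fun k => hη.exists_combination hU ((ℓ₁ k).comp F.hom)
  -- A point of `F₀` that dies in both `E₀` and `F₁` is zero, so the coordinates of `F₀` are
  -- combinations of those of `E₀` and `F₁`. The coefficients `ρ` define the retraction.
  choose ρ hρ using fun i => hη.exists_combination_of_vanishing hU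
    (Fin.append (fun k => (ℓ₀ k).comp Φ.left) (fun k => (ℓ₁ k).comp F.hom)) (η i)
    (fun T hT g hg => by
      rw [hΦ.isoOnH0.eq_zero g (hℓ₀.ext hT fun k => ?_) (hℓ₁.ext hT fun k => ?_), map_zero]
      · have := hg (Fin.castAdd _ k)
        rw [Fin.append_left] at this
        rw [map_zero]; exact this
      · have := hg (Fin.natAdd _ k)
        rw [Fin.append_right] at this
        rw [map_zero]; exact this)
  let P : Fin r → LinearForm E.left.space U := fun i =>
    .combination (fun k => ρ i (Fin.castAdd _ k)) ℓ₀
  let Q : Fin r → LinearForm F.right.space U := fun i =>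
    .combination (fun k => ρ i (Fin.natAdd _ k)) ℓ₁
  have hPQ : ∀ (T : Over X) (hT : LiesOver T U) (g : T ⟶ F.left.over) i,
      (P i).onPoints T hT (g ≫ homOver Φ.left) + (Q i).onPoints T hT (g ≫ homOver F.hom) =
        (η i).onPoints T hT g := by
    intro T hT g i
    rw [hρ i T hT g, Fin.sum_univ_add]
    simp only [Fin.append_left, Fin.append_right, P, Q, LinearForm.combination_onPoints]
    rfl
  -- With `g` the retraction of `(e, f)`, these two forms add up to `ℓ₀ k` of `e - Φ₀ g`, which is
  -- zero on `F₀`. Below, `ν₁` likewise descends `ℓ₁ k` of `f + D g`.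
  choose V₀ hxV₀ hVU₀ ν₀ hν₀ using fun k => hΦ.exists_form hU hxU hℓ₀ hξ
    ((ℓ₀ k).sub (.combination (c₀ k) P)) (.combination (c₀ k) Q) (fun T hT g => by
      have := hc₀ k T hT g
      simp only [← hPQ, mul_add, Finset.sum_add_distrib] at this
      simp only [LinearForm.sub_onPoints, LinearForm.combination_onPoints]
      rw [sub_eq_iff_eq_add, add_comm]
      exact this)
  choose V₁ hxV₁ hVU₁ ν₁ hν₁ using fun k => hΦ.exists_form hU hxU hℓ₀ hξ
    (.combination (c₁ k) P) ((ℓ₁ k).sub (.combination (c₁ k) Q)) (fun T hT g => by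
      have := hc₁ k T hT g
      simp only [← hPQ, mul_add, Finset.sum_add_distrib] at this
      simp only [LinearForm.sub_onPoints, LinearForm.combination_onPoints]
      rw [eq_sub_iff_add_eq]
      exact this.symm)
  obtain ⟨W₀, hxW₀, hW₀⟩ := exists_le_of_finite x V₀ hxV₀
  obtain ⟨W₁, hxW₁, hW₁⟩ := exists_le_of_finite x V₁ hxV₁
  obtain ⟨V, hV, hxV, hVle⟩ := exists_affine_le x (show x ∈ W₀ ⊓ W₁ ⊓ U from ⟨⟨hxW₀, hxW₁⟩, hxU⟩)
  have hVU : V ≤ U := hVle.trans inf_le_right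
  have hVV₀ : ∀ k, V ≤ V₀ k := fun k => (hVle.trans (inf_le_left.trans inf_le_left)).trans (hW₀ k)
  have hVV₁ : ∀ k, V ≤ V₁ k := fun k => (hVle.trans (inf_le_left.trans inf_le_right)).trans (hW₁ k)
  refine ⟨V, hxV, hV, n₀, m₀, n₁, m₁, p, q, _, _, _, _, _, _, fun k => (ν₀ k).res (hVV₀ k),
    fun k => (ν₁ k).res (hVV₁ k), hℓ₀.res hVU, hℓ₁.res hVU, hξ.res hVU, fun T hT e f => ?_⟩
  have hTU := hT.mono hVU
  -- The coordinates of a vector bundle satisfy no equations, so the retraction is defined on all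
  -- points. The minus sign matches `g ↦ (Φ₀ g, -D g)`.
  obtain ⟨g, hg⟩ := hη.exists_point hTU
    (fun i => (P i).onPoints T hTU e - (Q i).onPoints T hTU f) (fun j => j.elim0)
  refine ⟨g, fun k => ?_, fun k => ?_⟩
  · have h1 := (hν₀ k T (hT.mono (hVV₀ k))).1 e
    have h2 := (hν₀ k T (hT.mono (hVV₀ k))).2 f
    have h3 := hc₀ k T hTU g
    simp only [LinearForm.sub_onPoints, LinearForm.combination_onPoints] at h1 h2
    simp only [LinearForm.comp_onPoints, hg, mul_sub, Finset.sum_sub_distrib] at h3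
    change (ν₀ k).onPoints T (hT.mono (hVV₀ k)) _ = (ℓ₀ k).onPoints T hTU _
    rw [map_add, map_sub, h1, h2]
    refine Eq.trans ?_ (congrArg _ h3.symm)
    ring
  · have h1 := (hν₁ k T (hT.mono (hVV₁ k))).1 e
    have h2 := (hν₁ k T (hT.mono (hVV₁ k))).2 f
    have h3 := hc₁ k T hTU g
    simp only [LinearForm.sub_onPoints, LinearForm.combination_onPoints] at h1 h2
    simp only [LinearForm.comp_onPoints, hg, mul_sub, Finset.sum_sub_distrib] at h3
    change (ν₁ k).onPoints T (hT.mono (hVV₁ k)) _ = (ℓ₁ k).onPoints T hTU _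
    rw [map_add, map_add, h1, h2]
    refine Eq.trans ?_ (congrArg _ h3.symm)
    ring

theorem sumMap_onPoints (Φ : F ⟶ E) {T : Over X} (t : T ⟶ directSum E.left F.right) :
    t ≫ sumMap Φ = (t ≫ directSum.fst _ _) ≫ homOver E.hom +
      (t ≫ directSum.snd _ _) ≫ homOver Φ.right := by
  rw [sumMap, E.right.space.comp_add]
  simp only [Category.assoc]

/-- The sequence `F₀ → E₀ ⊕ F₁ → E₁` is locally split exact onto its image. -/
theorem GoingDownApplicable.exists_locally_exact (hΦ : GoingDownApplicable Φ) (x : X) :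
    ∃ V : X.Opens, x ∈ V ∧ ∀ (T : Over X) (hT : LiesOver T V),
      (∀ (e : T ⟶ E.left.over) (f : T ⟶ F.right.over),
        e ≫ homOver E.hom + f ≫ homOver Φ.right = 0 →
          ∃ g : T ⟶ F.left.over, g ≫ homOver Φ.left = e ∧ g ≫ homOver F.hom = -f) ∧
      ∀ s : T ⟶ E.right.over,
        (∀ μ : LinearForm E.right.space V, μ.VanishesOn (sumMap Φ) → μ.onPoints T hT s = 0) →
          ∃ (e : T ⟶ E.left.over) (f : T ⟶ F.right.over),
            e ≫ homOver E.hom + f ≫ homOver Φ.right = s := by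
  obtain ⟨V, hxV, hV, n₀, m₀, n₁, m₁, p, q, ℓ₀, A₀, ℓ₁, A₁, ξ, B, ν₀, ν₁, hℓ₀, hℓ₁, hξ, hν⟩ :=
    hΦ.exists_descended_coordinates x
  refine ⟨V, hxV, fun T hT => ⟨fun e f hef => ?_, fun s hs => ?_⟩⟩
  · obtain ⟨g, hg₀, hg₁⟩ := hν T hT e f
    refine ⟨g, ?_, ?_⟩
    · refine (sub_eq_zero.1 (hℓ₀.ext hT fun k => ?_)).symm
      rw [← hg₀, hef, map_zero, map_zero]
    · refine eq_neg_of_add_eq_zero_right (hℓ₁.ext hT fun k => ?_)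
      rw [← hg₁, hef, map_zero, map_zero]
  -- On the image of `q` the `ν₀ k` are coordinates of an actual point of `E₀`. The equations of
  -- `E₀` in the `ν₀ k` are therefore forms that vanish on the image, hence also at `s`.
  · obtain ⟨e, he⟩ := hℓ₀.exists_point hT (fun k => (ν₀ k).onPoints T hT s) (fun j => by
      have := hs (.combination (A₀ j) ν₀) (fun T' hT' t => by
        obtain ⟨g, hg₀, -⟩ := hν T' hT' (t ≫ directSum.fst _ _) (t ≫ directSum.snd _ _)
        rw [sumMap_onPoints, LinearForm.combination_onPoints]
        simp only [hg₀]
        exact hℓ₀.relation hT' _ j)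
      rwa [LinearForm.combination_onPoints] at this)
    obtain ⟨f, hf⟩ := hℓ₁.exists_point hT (fun k => (ν₁ k).onPoints T hT s) (fun j => by
      have := hs (.combination (A₁ j) ν₁) (fun T' hT' t => by
        obtain ⟨g, -, hg₁⟩ := hν T' hT' (t ≫ directSum.fst _ _) (t ≫ directSum.snd _ _)
        rw [sumMap_onPoints, LinearForm.combination_onPoints]
        simp only [hg₁]
        exact hℓ₁.relation hT' _ j)
      rwa [LinearForm.combination_onPoints] at this)
    refine ⟨e, f, hξ.ext hT fun l => ?_⟩
    obtain ⟨d₀, hd₀⟩ := hℓ₀.exists_combination hV ((ξ l).comp E.hom)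
    obtain ⟨d₁, hd₁⟩ := hℓ₁.exists_combination hV ((ξ l).comp Φ.right)
    -- Moving `(e, f)` along `F₀` does not change `q(e, f)`, so this form vanishes on the image of
    -- `q`. At `s` it says that the lift maps to `s`.
    have := hs ((ξ l).sub ((LinearForm.combination d₀ ν₀).add (.combination d₁ ν₁)))
      (fun T' hT' t => by
        obtain ⟨g, hg₀, hg₁⟩ := hν T' hT' (t ≫ directSum.fst _ _) (t ≫ directSum.snd _ _)
        rw [sumMap_onPoints, LinearForm.sub_onPoints, LinearForm.add_onPoints,
          LinearForm.combination_onPoints, LinearForm.combination_onPoints, sub_eq_zero]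
        simp only [hg₀, hg₁]
        rw [← hd₀, ← hd₁, LinearForm.comp_onPoints, LinearForm.comp_onPoints, ← map_add]
        congr 1
        have h1 := LinearHom.sub_comp E.hom (t ≫ directSum.fst _ _) (g ≫ homOver Φ.left)
        have h2 := Φ.right.map_add (t ≫ directSum.snd _ _) (g ≫ homOver F.hom)
        rw [h1, h2]
        have h3 := comp_square Φ g
        rw [h3]
        abel)
    rw [LinearForm.sub_onPoints, sub_eq_zero, LinearForm.add_onPoints,
      LinearForm.combination_onPoints, LinearForm.combination_onPoints] at this
    rw [map_add, this]
    congr 1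
    · refine (hd₀ T hT e).trans ?_
      simp only [he]
    · refine (hd₁ T hT f).trans ?_
      simp only [hf]

end Splitting

/-! ### Closed subschemes tested on points, and scheme-theoretic images. -/

section ClosedSubschemes

variable {X : Scheme.{u}}

theorem factorsThrough_iff {T Y : Over X} (s : T ⟶ Y) (I : Y.left.IdealSheafData) :
    FactorsThrough s I ↔ I ≤ s.left.ker := by
  constructor
  · rintro ⟨t, ht⟩
    have := Scheme.Hom.le_ker_comp t I.subschemeι
    rwa [ht, Scheme.IdealSheafData.ker_subschemeι] at this
  · intro h
    have h' : I.subschemeι.ker ≤ s.left.ker := by rwa [Scheme.IdealSheafData.ker_subschemeι]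
    exact ⟨IsClosedImmersion.lift I.subschemeι s.left h', IsClosedImmersion.lift_fac _ _ _⟩

theorem FactorsThrough.comp {T' T Y : Over X} {s : T ⟶ Y} {I : Y.left.IdealSheafData}
    (h : FactorsThrough s I) (f : T' ⟶ T) : FactorsThrough (f ≫ s) I := by
  obtain ⟨t, ht⟩ := h
  exact ⟨f.left ≫ t, by rw [Category.assoc, ht]; rfl⟩

theorem factorsThrough_comap {T Y Z : Over X} (s : T ⟶ Y) (f : Y ⟶ Z)
    (I : Z.left.IdealSheafData) :
    FactorsThrough s (I.comap f.left) ↔ FactorsThrough (s ≫ f) I := by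
  rw [factorsThrough_iff, factorsThrough_iff, Over.comp_left, Scheme.Hom.ker_comp,
    Scheme.IdealSheafData.le_map_iff_comap_le]

/-- The part of an `X`-scheme over an open subscheme. -/
noncomputable def restrictOver (T : Over X) (V : X.Opens) : Over X :=
  Over.mk ((T.hom ⁻¹ᵁ V).ι ≫ T.hom)

/-- The inclusion of the part of an `X`-scheme over an open subscheme. -/
noncomputable def restrictOver.ι (T : Over X) (V : X.Opens) : restrictOver T V ⟶ T :=
  Over.homMk (T.hom ⁻¹ᵁ V).ι

theorem liesOver_restrictOver (T : Over X) (V : X.Opens) : LiesOver (restrictOver T V) V :=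
  fun x _ => x.2

theorem restrictOver.w (T : Over X) (V : X.Opens) :
    (restrictOver.ι T V).left = (T.hom ⁻¹ᵁ V).ι := rfl

/-- A section over an open subset vanishes if it vanishes locally over the base. -/
theorem eq_zero_of_locally {T : Over X} {W : T.left.Opens} (a : Γ(T.left, W))
    (h : ∀ x : X, ∃ V : X.Opens, x ∈ V ∧ (restrictOver.ι T V).left.app W a = 0) : a = 0 := by
  apply T.left.IsSheaf.section_ext
  intro t ht
  obtain ⟨V, hxV, hV⟩ := h (T.hom t)
  refine ⟨(T.hom ⁻¹ᵁ V).ι ''ᵁ ((T.hom ⁻¹ᵁ V).ι ⁻¹ᵁ W), ?_, ⟨⟨t, hxV⟩, ht, rfl⟩, ?_⟩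
  · rintro _ ⟨y, hy, rfl⟩
    exact hy
  rw [map_zero]
  rw [restrictOver.w, Scheme.Opens.ι_app] at hV
  exact hV

/-- Factoring means that the pulled-back equations vanish, which can be tested on the preimages of a
cover of `X`. -/
theorem FactorsThrough.of_locally {T Y : Over X} {s : T ⟶ Y} {I : Y.left.IdealSheafData}
    (h : ∀ x : X, ∃ V : X.Opens, x ∈ V ∧ FactorsThrough (restrictOver.ι T V ≫ s) I) :
    FactorsThrough s I := by
  rw [factorsThrough_iff]
  refine Scheme.IdealSheafData.le_ofIdeals_iff.2 fun U a ha => ?_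
  rw [RingHom.mem_ker]
  refine eq_zero_of_locally (T := T) _ fun x => ?_
  obtain ⟨V, hxV, hV⟩ := h x
  refine ⟨V, hxV, ?_⟩
  rw [factorsThrough_iff] at hV
  have := Scheme.Hom.ideal_ker_le _ U (hV U ha)
  rw [RingHom.mem_ker, Over.comp_left, Scheme.Hom.comp_app] at this
  exact this

/-- Closed subschemes are compared on points with values in schemes over small open subschemes of
the base. -/
theorem le_of_locally {Y : Over X} {I J : Y.left.IdealSheafData}
    (h : ∀ x : X, ∃ V : X.Opens, x ∈ V ∧ ∀ (T : Over X), LiesOver T V → ∀ (s : T ⟶ Y),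
      FactorsThrough s J → FactorsThrough s I) : I ≤ J := by
  -- The inclusion of the closed subscheme of `J` is the universal point that factors through it.
  let Z : Over X := Over.mk (J.subschemeι ≫ Y.hom)
  let z : Z ⟶ Y := Over.homMk J.subschemeι
  have hz : FactorsThrough z J := ⟨𝟙 _, Category.id_comp _⟩
  have : FactorsThrough z I := .of_locally fun x => by
    obtain ⟨V, hxV, hV⟩ := h x
    exact ⟨V, hxV, hV _ (liesOver_restrictOver Z V) _ (hz.comp _)⟩
  rw [factorsThrough_iff] at this
  exact this.trans (Scheme.IdealSheafData.ker_subschemeι J).le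

theorem eq_of_locally {Y : Over X} {I J : Y.left.IdealSheafData}
    (h : ∀ x : X, ∃ V : X.Opens, x ∈ V ∧ ∀ (T : Over X), LiesOver T V → ∀ (s : T ⟶ Y),
      FactorsThrough s J ↔ FactorsThrough s I) : I = J :=
  le_antisymm
    (le_of_locally fun x => (h x).imp fun _ hV => ⟨hV.1, fun T hT s => (hV.2 T hT s).1⟩)
    (le_of_locally fun x => (h x).imp fun _ hV => ⟨hV.1, fun T hT s => (hV.2 T hT s).2⟩)

theorem onPoints_eq_zero_of_locally {L : LinearSpace X} {U : X.Opens} (μ : LinearForm L U)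
    {T : Over X} (hT : LiesOver T U) (s : T ⟶ L.toOver)
    (h : ∀ x : X, ∃ V : X.Opens, x ∈ V ∧
      ∀ h' : LiesOver (restrictOver T V) U, μ.onPoints _ h' (restrictOver.ι T V ≫ s) = 0) :
    μ.onPoints T hT s = 0 := by
  refine eq_zero_of_locally (T := T) (W := ⊤) _ fun x => ?_
  obtain ⟨V, hxV, hV⟩ := h x
  refine ⟨V, hxV, ?_⟩
  have := hV (hT.comp (restrictOver.ι T V))
  rwa [μ.naturality _ hT] at this

/-- The closed subscheme of the image cut out by this kernel has, in `Z`, the same ideal as the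
image. The image therefore factors through it, so the kernel is zero. -/
theorem ker_toImage {Y Z : Scheme.{u}} (f : Y ⟶ Z) : f.toImage.ker = ⊥ := by
  have h : (f.toImage.ker.subschemeι ≫ f.imageι).ker ≤ f.imageι.ker := by
    rw [Scheme.Hom.ker_comp, Scheme.IdealSheafData.ker_subschemeι, Scheme.IdealSheafData.map_ker,
      f.toImage_imageι, Scheme.IdealSheafData.ker_subschemeι]
  have h' := IsClosedImmersion.lift_fac (f.toImage.ker.subschemeι ≫ f.imageι) f.imageι h
  rw [← Category.assoc] at h'
  have h'' : IsClosedImmersion.lift _ f.imageι h ≫ f.toImage.ker.subschemeι = 𝟙 _ :=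
    (cancel_mono f.imageι).1 (h'.trans (Category.id_comp _).symm)
  have := Scheme.Hom.le_ker_comp (IsClosedImmersion.lift _ f.imageι h) f.toImage.ker.subschemeι
  rw [h'', Scheme.IdealSheafData.ker_subschemeι, Scheme.Hom.ker_eq_bot_of_isIso (𝟙 _)] at this
  exact le_bot_iff.1 this

theorem ker_morphismRestrict_eq_bot {Y Z : Scheme.{u}} (f : Y ⟶ Z) [QuasiCompact f]
    (hf : f.ker = ⊥) (W : Z.Opens) : (f ∣_ W).ker = ⊥ := by
  ext V : 2
  rw [Scheme.ker_morphismRestrict_ideal, hf]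
  rfl

/-- The scheme-theoretic image, as an `X`-scheme. -/
noncomputable def imageOver {Y Z : Over X} (h : Y ⟶ Z) : Over X :=
  Over.mk (h.left.imageι ≫ Z.hom)

/-- The inclusion of the scheme-theoretic image. -/
noncomputable def imageOver.ι {Y Z : Over X} (h : Y ⟶ Z) : imageOver h ⟶ Z :=
  Over.homMk h.left.imageι

/-- Locally over the base, the scheme-theoretic image of `h : Y ⟶ Z` is dominated by `Y`. -/
theorem exists_dominating_image {Y Z : Over X} (h : Y ⟶ Z) [QuasiCompact h.left] (V : X.Opens) :
    ∃ (T : Over X) (t : T ⟶ restrictOver (imageOver h) V) (y : T ⟶ Y),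
      t ≫ restrictOver.ι _ V ≫ imageOver.ι h = y ≫ h ∧ t.left.ker = ⊥ ∧ QuasiCompact t.left := by
  let W : h.left.image.Opens := (imageOver h).hom ⁻¹ᵁ V
  let T : Over X := Over.mk ((h.left.toImage ∣_ W) ≫ (restrictOver (imageOver h) V).hom)
  have hw : (h.left.toImage ⁻¹ᵁ W).ι ≫ h.left = (h.left.toImage ∣_ W) ≫ W.ι ≫ h.left.imageι := by
    have := morphismRestrict_ι_assoc h.left.toImage W h.left.imageι
    rw [h.left.toImage_imageι] at this
    exact this.symm
  refine ⟨T, Over.homMk (h.left.toImage ∣_ W), Over.homMk (h.left.toImage ⁻¹ᵁ W).ι (by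
    rw [← Over.w h, ← Category.assoc, hw]
    simp only [Category.assoc]
    rfl), Over.OverMorphism.ext ?_, ker_morphismRestrict_eq_bot _ (ker_toImage _) W,
    (inferInstance : QuasiCompact (h.left.toImage ∣_ W))⟩
  simp only [Over.comp_left]
  exact hw.symm

theorem FactorsThrough.of_comp {T' T L : Over X} {t : T' ⟶ T} (ht : t.left.ker = ⊥) {s : T ⟶ L}
    {I : L.left.IdealSheafData} (h : FactorsThrough (t ≫ s) I) : FactorsThrough s I := by
  rwa [factorsThrough_iff, Over.comp_left, Scheme.Hom.ker_comp, ht,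
    Scheme.IdealSheafData.map_bot, ← factorsThrough_iff] at h

theorem appTop_injective_of_ker_eq_bot {Y Z : Scheme.{u}} (f : Y ⟶ Z) [QuasiCompact f]
    (hf : f.ker = ⊥) (a : Γ(Z, ⊤)) (ha : f.appTop a = 0) : a = 0 := by
  apply Z.IsSheaf.section_ext
  intro z _
  obtain ⟨U, hU, hzU, hle⟩ := exists_affine_le z (U := ⊤) trivial
  refine ⟨U, hle, hzU, ?_⟩
  rw [map_zero]
  have hmem : Z.presheaf.map (homOfLE hle).op a ∈ f.ker.ideal ⟨U, hU⟩ := by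
    rw [Scheme.Hom.ker_apply, RingHom.mem_ker]
    have := congr($(f.naturality (homOfLE hle).op) a)
    refine this.trans ?_
    change Y.presheaf.map _ (f.appTop a) = 0
    rw [ha, map_zero]
  rw [hf] at hmem
  exact hmem

theorem exists_lift_opens {Y Z : Scheme.{u}} (f : Y ⟶ Z) (W : Z.Opens) (h : ∀ y, f y ∈ W) :
    ∃ g : Y ⟶ W.toScheme, g ≫ W.ι = f :=
  have h' : Set.range f ⊆ Set.range W.ι := by
    rw [Scheme.Opens.range_ι]
    rintro _ ⟨y, rfl⟩
    exact h y
  ⟨IsOpenImmersion.lift W.ι f h', IsOpenImmersion.lift_fac _ _ _⟩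

/-- Factorization of a morphism through the part of the target over an open subscheme. -/
theorem exists_lift_restrictOver {T Z : Over X} {V : X.Opens} (hT : LiesOver T V) (s : T ⟶ Z) :
    ∃ t : T ⟶ restrictOver Z V, t ≫ restrictOver.ι Z V = s := by
  obtain ⟨g, hg⟩ := exists_lift_opens s.left (Z.hom ⁻¹ᵁ V) fun y => by
    have := hT (x := y) trivial
    rw [← Over.w s] at this
    exact this
  refine ⟨Over.homMk g ?_, Over.OverMorphism.ext hg⟩
  refine Eq.trans ?_ (Over.w s)
  exact (Category.assoc _ _ _).symm.trans (congrArg (· ≫ Z.hom) hg)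

end ClosedSubschemes

/-! ### Existence and uniqueness of the push-forward. -/

section Pushforward

variable {X : Scheme.{u}}

theorem directSum.exists_lift {E F : Lin X} {T : Over X} (e : T ⟶ E.over) (f : T ⟶ F.over) :
    ∃ t : T ⟶ directSum E F, t ≫ directSum.fst E F = e ∧ t ≫ directSum.snd E F = f := by
  have w : e.left ≫ E.over.hom = f.left ≫ F.over.hom := by rw [Over.w, Over.w]
  refine ⟨Over.homMk (Limits.pullback.lift e.left f.left w) ?_, Over.OverMorphism.ext ?_,
    Over.OverMorphism.ext ?_⟩
  · refine Eq.trans ?_ (Over.w e)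
    exact (Category.assoc _ _ _).symm.trans (congrArg (· ≫ E.over.hom)
      (Limits.pullback.lift_fst _ _ w))
  · exact Limits.pullback.lift_fst _ _ w
  · exact Limits.pullback.lift_snd _ _ w

variable {F E : TwoTermComplex X}

instance quasiCompact_sumMap (Φ : F ⟶ E) : QuasiCompact (sumMap Φ).left := by
  have h₀ : IsAffineHom E.left.over.hom := E.left.space.isAffineHom
  have h₁ : IsAffineHom F.right.over.hom := F.right.space.isAffineHom
  have h₂ : IsAffineHom E.right.over.hom := E.right.space.isAffineHom
  have : QuasiCompact ((sumMap Φ).left ≫ E.right.over.hom) := by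
    rw [Over.w]
    exact inferInstanceAs
      (QuasiCompact (Limits.pullback.fst E.left.over.hom F.right.over.hom ≫ E.left.over.hom))
  exact QuasiCompact.of_comp _ E.right.over.hom

/-- The closed subscheme `E₀ ⊕ C` of `E₀ ⊕ F₁`. -/
noncomputable def coneSum (E₀ : Lin X) {F₁ : Lin X} (C : LinCone F₁) : Over X :=
  Over.mk ((C.ideal.comap (directSum.snd E₀ F₁).left).subschemeι ≫ (directSum E₀ F₁).hom)

/-- The inclusion of `E₀ ⊕ C` into `E₀ ⊕ F₁`. -/
noncomputable def coneSum.ι (E₀ : Lin X) {F₁ : Lin X} (C : LinCone F₁) :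
    coneSum E₀ C ⟶ directSum E₀ F₁ :=
  Over.homMk (C.ideal.comap (directSum.snd E₀ F₁).left).subschemeι

/-- The restriction of `E₀ ⊕ F₁ ⟶ E₁` to `E₀ ⊕ C`. -/
noncomputable def coneMap (Φ : F ⟶ E) (C : LinCone F.right) : coneSum E.left C ⟶ E.right.over :=
  coneSum.ι E.left C ≫ sumMap Φ

instance quasiCompact_coneMap (Φ : F ⟶ E) (C : LinCone F.right) :
    QuasiCompact (coneMap Φ C).left := by
  have : QuasiCompact (coneSum.ι E.left C).left :=
    inferInstanceAs (QuasiCompact (Scheme.IdealSheafData.subschemeι _))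
  exact inferInstanceAs (QuasiCompact ((coneSum.ι E.left C).left ≫ (sumMap Φ).left))

theorem factorsThrough_coneSum (E₀ : Lin X) {F₁ : Lin X} (C : LinCone F₁) :
    FactorsThrough (coneSum.ι E₀ C ≫ directSum.snd E₀ F₁) C.ideal := by
  rw [← factorsThrough_comap]
  exact ⟨𝟙 _, Category.id_comp _⟩

theorem factorsThrough_ker_coneMap (Φ : F ⟶ E) {C : LinCone F.right} {T : Over X}
    (e : T ⟶ E.left.over) {f : T ⟶ F.right.over} (hf : FactorsThrough f C.ideal) :
    FactorsThrough (e ≫ homOver E.hom + f ≫ homOver Φ.right) (coneMap Φ C).left.ker := by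
  obtain ⟨t, rfl, rfl⟩ := directSum.exists_lift e f
  rw [← factorsThrough_comap] at hf
  obtain ⟨r, hr⟩ := hf
  rw [← sumMap_onPoints]
  let r' : T ⟶ coneSum E.left C := Over.homMk r (by
    rw [← Over.w t, ← hr]
    exact (Category.assoc _ _ _).symm)
  have h : t ≫ sumMap Φ = r' ≫ coneMap Φ C := by
    rw [coneMap, ← Category.assoc]
    congr 1
    exact Over.OverMorphism.ext hr.symm
  rw [h, factorsThrough_iff]
  exact Scheme.Hom.le_ker_comp r'.left (coneMap Φ C).left

/-- Locally on `X`, the points of the cone `C'` are the images of the points of `E₀ ⊕ C`. -/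
def IsImageCone (Φ : F ⟶ E) (C : LinCone F.right) (C' : LinCone E.right) : Prop :=
  ∀ x : X, ∃ V : X.Opens, x ∈ V ∧ ∀ (T : Over X), LiesOver T V → ∀ s : T ⟶ E.right.over,
    FactorsThrough s C'.ideal ↔ ∃ (e : T ⟶ E.left.over) (f : T ⟶ F.right.over),
      FactorsThrough f C.ideal ∧ e ≫ homOver E.hom + f ≫ homOver Φ.right = s

variable {Φ : F ⟶ E} {C : LinCone F.right} {C' : LinCone E.right}

/-- Two points with the same image under `q` differ by a point of `F₀`, and `C` is stable under
`F₀`. -/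
theorem LinCone.IsConeUnder.factorsThrough_of_eq (hC : C.IsConeUnder F.hom) {T : Over X}
    (hex : ∀ (e : T ⟶ E.left.over) (f : T ⟶ F.right.over),
        e ≫ homOver E.hom + f ≫ homOver Φ.right = 0 →
          ∃ g : T ⟶ F.left.over, g ≫ homOver Φ.left = e ∧ g ≫ homOver F.hom = -f)
    {e e' : T ⟶ E.left.over} {f f' : T ⟶ F.right.over}
    (h : e ≫ homOver E.hom + f ≫ homOver Φ.right = e' ≫ homOver E.hom + f' ≫ homOver Φ.right)
    (hf' : FactorsThrough f' C.ideal) : FactorsThrough f C.ideal := by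
  obtain ⟨g, -, hg⟩ := hex (e' - e) (f' - f) (by
    have h1 := LinearHom.sub_comp E.hom e' e
    have h2 := LinearHom.sub_comp Φ.right f' f
    rw [h1, h2, sub_add_sub_comm, h, sub_self])
  have := hC T g f' hf'
  rwa [hg, neg_sub, sub_add_cancel] at this

/-- A scheme-theoretic image usually has more points than the naive one. Here they agree locally,
because the tautological point of the image lifts to `E₀ ⊕ C`, and every other point is pulled back
from it. -/
theorem GoingDownApplicable.exists_factorsThrough_ker_iff (hΦ : GoingDownApplicable Φ)
    (hC : C.IsConeUnder F.hom) (x : X) :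
    ∃ V : X.Opens, x ∈ V ∧ ∀ (T : Over X), LiesOver T V → ∀ s : T ⟶ E.right.over,
      FactorsThrough s (coneMap Φ C).left.ker ↔
        ∃ (e : T ⟶ E.left.over) (f : T ⟶ F.right.over),
          FactorsThrough f C.ideal ∧ e ≫ homOver E.hom + f ≫ homOver Φ.right = s := by
  obtain ⟨V, hxV, hV⟩ := hΦ.exists_locally_exact x
  refine ⟨V, hxV, fun T hT s => ⟨fun hs => ?_, ?_⟩⟩
  swap
  · rintro ⟨e, f, hf, rfl⟩
    exact factorsThrough_ker_coneMap Φ e hf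
  set h := coneMap Φ C
  have hZ := liesOver_restrictOver (imageOver h) V
  obtain ⟨T₀, t, y, hty, ht, htq⟩ := exists_dominating_image h V
  -- A form that kills `im q` vanishes after pull-back to `T₀`, which maps to `E₀ ⊕ C`, and
  -- functions on the image inject into functions on `T₀`.
  obtain ⟨e₀, f₀, hef⟩ := (hV _ hZ).2 (restrictOver.ι _ V ≫ imageOver.ι h) (fun μ hμ => by
    apply appTop_injective_of_ker_eq_bot t.left ht
    have := μ.naturality (hZ.comp t) hZ t (restrictOver.ι _ V ≫ imageOver.ι h)
    refine this.symm.trans ?_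
    rw [hty]
    have hy : y ≫ h = (y ≫ coneSum.ι E.left C) ≫ sumMap Φ := (Category.assoc _ _ _).symm
    rw [hy]
    exact hμ T₀ _ _)
  -- Over `T₀` the lift competes with a second one through `E₀ ⊕ C`, so its `F₁`-component lies in
  -- `C` there. This descends because `t` has zero kernel.
  have hf₀ : FactorsThrough f₀ C.ideal := by
    refine FactorsThrough.of_comp ht ?_
    have hc := (factorsThrough_coneSum E.left C).comp y
    refine hC.factorsThrough_of_eq (hV T₀ (hZ.comp t)).1 (e := t ≫ e₀)
      (e' := (y ≫ coneSum.ι E.left C) ≫ directSum.fst _ _) ?_ hc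
    have h1 := sumMap_onPoints Φ (y ≫ coneSum.ι E.left C)
    have hy : (y ≫ coneSum.ι E.left C) ≫ sumMap Φ = y ≫ h := Category.assoc _ _ _
    rw [← Category.assoc y, ← h1, hy, ← hty, ← hef, E.right.space.comp_add, Category.assoc,
      Category.assoc]
  obtain ⟨r, hr⟩ := hs
  let r' : T ⟶ imageOver h := Over.homMk r (by
    rw [← Over.w s, ← hr]
    exact (Category.assoc _ _ _).symm)
  obtain ⟨v, hv⟩ := exists_lift_restrictOver hT r'
  refine ⟨v ≫ e₀, v ≫ f₀, hf₀.comp v, ?_⟩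
  rw [Category.assoc, Category.assoc, ← E.right.space.comp_add, hef, ← Category.assoc, hv]
  exact Over.OverMorphism.ext hr

theorem GoingDownApplicable.exists_isImageCone (hΦ : GoingDownApplicable Φ)
    (hC : C.IsConeUnder F.hom) : ∃ C' : LinCone E.right, IsImageCone Φ C C' := by
  refine ⟨⟨(coneMap Φ C).left.ker, fun T => ?_, fun T a s hs => ?_⟩,
    hΦ.exists_factorsThrough_ker_iff hC⟩
  · have := factorsThrough_ker_coneMap Φ (0 : T ⟶ E.left.over) (C.zero_mem T)
    have h1 := LinearHom.zero_comp E.hom T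
    have h2 := LinearHom.zero_comp Φ.right T
    rwa [h1, h2, add_zero] at this
  · refine .of_locally fun x => ?_
    obtain ⟨V, hxV, hV⟩ := hΦ.exists_factorsThrough_ker_iff hC x
    refine ⟨V, hxV, ?_⟩
    have hTV := liesOver_restrictOver T V
    obtain ⟨e, f, hf, hef⟩ := (hV _ hTV _).1 (hs.comp (restrictOver.ι T V))
    rw [E.right.space.comp_smul, ← hef]
    refine (hV _ hTV _).2 ⟨(restrictOver.ι T V).left.appTop a • e,
      (restrictOver.ι T V).left.appTop a • f, C.smul_mem _ _ _ hf, ?_⟩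
    have h1 := LinearHom.map_smul E.hom ((restrictOver.ι T V).left.appTop a) e
    have h2 := LinearHom.map_smul Φ.right ((restrictOver.ι T V).left.appTop a) f
    rw [h1, h2, smul_add]

theorem IsImageCone.unique {C'' : LinCone E.right} (h : IsImageCone Φ C C')
    (h' : IsImageCone Φ C C'') : C' = C'' := by
  refine LinCone.ext (eq_of_locally fun x => ?_)
  obtain ⟨V, hxV, hV⟩ := h x
  obtain ⟨V', hxV', hV'⟩ := h' x
  exact ⟨V ⊓ V', ⟨hxV, hxV'⟩, fun T hT s =>
    (hV' T (hT.mono inf_le_right) s).trans (hV T (hT.mono inf_le_left) s).symm⟩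

/-- Exactness at `E₀ ⊕ F₁` together with stability of `C` keeps `q⁻¹(C')` from exceeding `E₀ ⊕ C`.
-/
theorem IsImageCone.isPushforward (h : IsImageCone Φ C C') (hΦ : GoingDownApplicable Φ)
    (hC : C.IsConeUnder F.hom) : IsPushforward Φ C C' where
  isInImage U μ hμ T hT s hs := onPoints_eq_zero_of_locally μ hT s fun x => by
    obtain ⟨V, hxV, hV⟩ := h x
    refine ⟨V, hxV, fun h' => ?_⟩
    obtain ⟨e, f, -, hef⟩ := (hV _ (liesOver_restrictOver T V) _).1 (hs.comp (restrictOver.ι T V))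
    obtain ⟨t, rfl, rfl⟩ := directSum.exists_lift e f
    rw [← hef, ← sumMap_onPoints]
    exact hμ _ h' t
  preimage_eq := eq_of_locally fun x => by
    obtain ⟨V, hxV, hV⟩ := h x
    obtain ⟨V', hxV', hV'⟩ := hΦ.exists_locally_exact x
    refine ⟨V ⊓ V', ⟨hxV, hxV'⟩, fun T hT t => ?_⟩
    rw [factorsThrough_comap, factorsThrough_comap, sumMap_onPoints,
      hV T (hT.mono inf_le_left)]
    constructor
    · intro hf
      exact ⟨_, _, hf, rfl⟩
    · rintro ⟨e, f, hf, hef⟩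
      exact hC.factorsThrough_of_eq (hV' T (hT.mono inf_le_right)).1 hef.symm hf

/-- A point of `C'` lies in `im q`, hence lifts locally, and `q⁻¹(C') = E₀ ⊕ C` places the lift.
Uniqueness of the push-forward follows from this description. -/
theorem IsPushforward.isImageCone (h : IsPushforward Φ C C') (hΦ : GoingDownApplicable Φ) :
    IsImageCone Φ C C' := fun x => by
  obtain ⟨V, hxV, hV⟩ := hΦ.exists_locally_exact x
  have key : ∀ {T : Over X} (e : T ⟶ E.left.over) (f : T ⟶ F.right.over),
      FactorsThrough (e ≫ homOver E.hom + f ≫ homOver Φ.right) C'.ideal ↔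
        FactorsThrough f C.ideal := by
    intro T e f
    obtain ⟨t, rfl, rfl⟩ := directSum.exists_lift e f
    rw [← sumMap_onPoints, ← factorsThrough_comap, ← factorsThrough_comap, h.preimage_eq]
  refine ⟨V, hxV, fun T hT s => ⟨fun hs => ?_, ?_⟩⟩
  · obtain ⟨e, f, rfl⟩ := (hV T hT).2 s fun μ hμ => h.isInImage V μ hμ T hT s hs
    exact ⟨e, f, (key e f).1 hs, rfl⟩
  · rintro ⟨e, f, hf, rfl⟩
    exact (key e f).2 hf

theorem GoingDownApplicable.existsUnique_isPushforward (hΦ : GoingDownApplicable Φ)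
    (hC : C.IsConeUnder F.hom) : ∃! C', IsPushforward Φ C C' := by
  obtain ⟨C', hC'⟩ := hΦ.exists_isImageCone hC
  exact ⟨C', hC'.isPushforward hΦ hC, fun C'' h => (h.isImageCone hΦ).unique hC'⟩

theorem GoingDownApplicable.isPushforward_pushforward (hΦ : GoingDownApplicable Φ)
    (hC : C.IsConeUnder F.hom) : IsPushforward Φ C (pushforward Φ C) := by
  have h := (hΦ.existsUnique_isPushforward hC).exists
  rw [pushforward, dif_pos h]
  exact h.choose_spec

/-- The summand `E₀` absorbs the translation. -/
theorem IsImageCone.isConeUnder (h : IsImageCone Φ C C') : C'.IsConeUnder E.hom := by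
  intro T e s hs
  refine .of_locally fun x => ?_
  obtain ⟨V, hxV, hV⟩ := h x
  refine ⟨V, hxV, ?_⟩
  have hTV := liesOver_restrictOver T V
  obtain ⟨e', f, hf, hef⟩ := (hV _ hTV _).1 (hs.comp (restrictOver.ι T V))
  refine (hV _ hTV _).2 ⟨restrictOver.ι T V ≫ e + e', f, hf, ?_⟩
  have h1 := LinearHom.map_add E.hom (restrictOver.ι T V ≫ e) e'
  rw [h1, E.right.space.comp_add, ← hef, add_assoc, Category.assoc]

end Pushforward

/-! ### Functoriality. -/

section Composition

variable {X : Scheme.{u}} {G F E : TwoTermComplex X} {Ψ : G ⟶ F} {Φ : F ⟶ E}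

theorem GoingDownApplicable.comp (hΨ : GoingDownApplicable Ψ) (hΦ : GoingDownApplicable Φ) :
    GoingDownApplicable (Ψ ≫ Φ) where
  isVectorBundle := hΨ.isVectorBundle
  isoOnH0 T z hz := by
    obtain ⟨y, ⟨hy₁, hy₂⟩, hy⟩ := hΦ.isoOnH0 T z hz
    obtain ⟨x, ⟨hx₁, hx₂⟩, hx⟩ := hΨ.isoOnH0 T y hy₁
    have hcomp : ∀ w : T ⟶ G.left.over,
        w ≫ homOver (Ψ ≫ Φ).left = (w ≫ homOver Ψ.left) ≫ homOver Φ.left :=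
      fun w => (Category.assoc _ _ _).symm
    refine ⟨x, ⟨hx₁, by rw [hcomp, hx₂, hy₂]⟩, fun w ⟨hw₁, hw₂⟩ => hx w ⟨hw₁, hy _ ⟨?_, ?_⟩⟩⟩
    · rw [comp_square, hw₁]
      exact LinearHom.zero_comp Ψ.right T
    · rw [← hcomp, hw₂]
  closedEmbeddingOnH1 U μ hμ x hx := by
    obtain ⟨V, hxV, hVU, ν, hν₀, hν⟩ := hΨ.closedEmbeddingOnH1 U μ hμ x hx
    obtain ⟨W, hxW, hWV, ω, hω₀, hω⟩ := hΦ.closedEmbeddingOnH1 V ν hν₀ x hxV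
    refine ⟨W, hxW, hWV.trans hVU, ω, hω₀, fun T hW hU s => ?_⟩
    rw [← hν T (hW.mono hWV) hU s, ← hω T hW (hW.mono hWV)]
    congr 1

theorem IsImageCone.comp {C : LinCone G.right} {C' : LinCone F.right} {C'' : LinCone E.right}
    (h : IsImageCone Ψ C C') (h' : IsImageCone Φ C' C'') : IsImageCone (Ψ ≫ Φ) C C'' := by
  intro x
  obtain ⟨V, hxV, hV⟩ := h x
  obtain ⟨V', hxV', hV'⟩ := h' x
  refine ⟨V ⊓ V', ⟨hxV, hxV'⟩, fun T hT s => ?_⟩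
  have hcomp : ∀ w : T ⟶ G.right.over,
      w ≫ homOver (Ψ ≫ Φ).right = (w ≫ homOver Ψ.right) ≫ homOver Φ.right :=
    fun w => (Category.assoc _ _ _).symm
  rw [hV' T (hT.mono inf_le_right)]
  constructor
  · rintro ⟨e, f, hf, rfl⟩
    obtain ⟨e', c, hc, rfl⟩ := (hV T (hT.mono inf_le_left) f).1 hf
    -- Since `Φ` is a commutative square, `Φ₁ D_F e' = D_E Φ₀ e'`, so `e'` is carried into `E₀`.
    refine ⟨e + e' ≫ homOver Φ.left, c, hc, ?_⟩
    have h1 := LinearHom.map_add E.hom e (e' ≫ homOver Φ.left)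
    have h2 := LinearHom.map_add Φ.right (e' ≫ homOver F.hom) (c ≫ homOver Ψ.right)
    rw [h1, h2, hcomp, comp_square, add_assoc]
  · rintro ⟨e, c, hc, rfl⟩
    refine ⟨e, c ≫ homOver Ψ.right, (hV T (hT.mono inf_le_left) _).2 ⟨0, c, hc, ?_⟩, ?_⟩
    · have h1 := LinearHom.zero_comp F.hom T
      rw [h1, zero_add]
    · rw [hcomp]

end Composition

end LinearSpaces

theorem mainTheorem7 (k : Type u) [Field k] (X : Scheme.{u}) (p : X ⟶ Spec (CommRingCat.of k))
    [LocallyOfFiniteType p] [QuasiCompact p]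
    (G F E : LinearSpaces.TwoTermComplex X) (Ψ : G ⟶ F) (Φ : F ⟶ E)
    (hΨ : LinearSpaces.GoingDownApplicable Ψ) (hΦ : LinearSpaces.GoingDownApplicable Φ)
    (C : LinearSpaces.LinCone G.right) (hC : C.IsConeUnder G.hom) :
    LinearSpaces.GoingDownApplicable (Ψ ≫ Φ) ∧
    (∃! C', LinearSpaces.IsPushforward Ψ C C') ∧
    (LinearSpaces.pushforward Ψ C).IsConeUnder F.hom ∧
    (∃! C', LinearSpaces.IsPushforward Φ (LinearSpaces.pushforward Ψ C) C') ∧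
    (∃! C', LinearSpaces.IsPushforward (Ψ ≫ Φ) C C') ∧
    LinearSpaces.pushforward (Ψ ≫ Φ) C =
      LinearSpaces.pushforward Φ (LinearSpaces.pushforward Ψ C) := by
  have hΨΦ := hΨ.comp hΦ
  have h₁ := (hΨ.isPushforward_pushforward hC).isImageCone hΨ
  have hC₁ := h₁.isConeUnder
  have h₂ := (hΦ.isPushforward_pushforward hC₁).isImageCone hΦ
  exact ⟨hΨΦ, hΨ.existsUnique_isPushforward hC, hC₁, hΦ.existsUnique_isPushforward hC₁,
    hΨΦ.existsUnique_isPushforward hC,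
    ((hΨΦ.isPushforward_pushforward hC).isImageCone hΨΦ).unique (h₁.comp h₂)⟩
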